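/- Let $k,b\ge 2$ be integers. A real number $x$ is called $(k,b)$-automatic if $x=a_0+\sum_{i\ge 1}a_i b^{-i}$ with $a_0\in\mathbb Z$ and $a_i\in\{0,\dots,b-1\}$ for $i\ge 1$, and there is a deterministic finite automaton with output which, for every $n\ge 0$, on reading the radix-$k$ expansion $w_r\cdots w_0$ of $n=\sum_i w_ik^i$ (most significant digit first, no leading zeros, the expansion of $0$ being the empty word) outputs $a_n$. A real number $x$ is called computable in logspace if there is a deterministic multitape Turing machine, with a read-only input tape (whose head stays on the input and the two blank cells next to it), finitely many work tapes and a write-only one-way output tape, which for every $n\ge 0$ on input $0^n$ halts with a string $\pm s_p\cdots s_0.t_1\cdots t_q$ ($p,q\ge 0$, $s_i,t_j\in\{0,1\}$, the sign being a minus sign or absent) on its output tape such that the dyadic number $d=\pm\bigl(\sum_{i=0}^{p}s_i2^i+\sum_{j=1}^{q}t_j2^{-j}\bigr)$ satisfies $|d-x|\le 2^{-n}$, and for which the number of work-tape cells scanned on input $0^n$ is $O(\log n)$ as $n\to\infty$. Theorem. Every $(k,b)$-automatic real number is computable in logspace. -/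

import Mathlib

open Filter Asymptotics

/-- One-cell head moves of a Turing machine. -/
inductive HeadMove where
  | left : HeadMove
  | stay : HeadMove
  | right : HeadMove

/-- What a machine does in one step: new state, move of the input head, for every work tape the
symbol to be written and the move of its head, and possibly one symbol to be appended to the
output tape. -/
structure TMAction (O Q Γ : Type) (m : ℕ) where
  state : Q
  inputMove : HeadMove
  write : Fin m → Γ
  move : Fin m → HeadMove
  emit : Option O

/-- A deterministic multitape Turing machine with a read-only two-way input tape over `I`,
finitely many two-way infinite work tapes over the alphabet `Γ` (with a blank symbol), and a
write-only one-way output tape over `O`. The transition function sees the state, the scanned input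
symbol (`none` is the blank next to the input word) and the scanned work symbols; the value `none`
means that the machine halts. -/
structure MultitapeTM (I O : Type) where
  Q : Type
  finite_Q : Finite Q
  Γ : Type
  finite_Γ : Finite Γ
  blank : Γ
  tapes : ℕ
  start : Q
  trans : Q → Option I → (Fin tapes → Γ) → Option (TMAction O Q Γ tapes)

namespace MultitapeTM

variable {I O : Type}

/-- Configurations. -/
structure Cfg (M : MultitapeTM I O) where
  state : M.Q
  inputPos : ℕ
  work : Fin M.tapes → ℤ → M.Γ
  head : Fin M.tapes → ℤ
  output : List O

/-- Initial configuration: the input head is on the first cell of the input (cell `1`), all work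
tapes and the output tape are empty. -/
def init (M : MultitapeTM I O) : M.Cfg where
  state := M.start
  inputPos := 1
  work := fun _ _ => M.blank
  head := fun _ => 0
  output := []

/-- The input word occupies the cells `1, …, |w|`; the cells `0` and `|w| + 1` are blank. -/
def readInput (w : List I) (p : ℕ) : Option I :=
  if p = 0 then none else w[p - 1]?

/-- The input head never leaves the cells `0, …, |w| + 1`: a move beyond them has no effect. -/
def moveInput (w : List I) (p : ℕ) : HeadMove → ℕ
  | .left => p - 1
  | .stay => p
  | .right => min (p + 1) (w.length + 1)

/-- Move of a work head. -/
def moveHead (p : ℤ) : HeadMove → ℤ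
  | .left => p - 1
  | .stay => p
  | .right => p + 1

/-- The action prescribed in a configuration, `none` if the machine has halted. -/
def action (M : MultitapeTM I O) (w : List I) (c : M.Cfg) :
    Option (TMAction O M.Q M.Γ M.tapes) :=
  M.trans c.state (readInput w c.inputPos) (fun j => c.work j (c.head j))

/-- One step on input `w`; a halting configuration is left unchanged. -/
def step (M : MultitapeTM I O) (w : List I) (c : M.Cfg) : M.Cfg :=
  match M.action w c with
  | none => c
  | some α =>
    { state := α.state
      inputPos := moveInput w c.inputPos α.inputMove
      work := fun j => Function.update (c.work j) (c.head j) (α.write j)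
      head := fun j => moveHead (c.head j) (α.move j)
      output := c.output ++ α.emit.toList }

/-- The configuration after `τ` steps on input `w`. -/
def cfgAt (M : MultitapeTM I O) (w : List I) (τ : ℕ) : M.Cfg :=
  (M.step w)^[τ] M.init

/-- On input `w` the machine halts and the content of its output tape is then `v`. -/
def Outputs (M : MultitapeTM I O) (w : List I) (v : List O) : Prop :=
  ∃ τ : ℕ, M.action w (M.cfgAt w τ) = none ∧ (M.cfgAt w τ).output = v

/-- The number of work tape cells scanned during the computation on input `w`. The input tape and
the output tape do not count. -/
noncomputable def spaceUsed (M : MultitapeTM I O) (w : List I) : ℕ∞ :=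
  Set.encard {c : Fin M.tapes × ℤ | ∃ τ : ℕ, (M.cfgAt w τ).head c.1 = c.2}

end MultitapeTM

/-- Symbols occurring in representations of dyadic numbers: a minus sign, the binary point and
the binary digits. -/
inductive DyadicSymbol where
  | minus : DyadicSymbol
  | point : DyadicSymbol
  | digit : Fin 2 → DyadicSymbol

/-- The string `v` represents the dyadic number `d` in base 2: `v` is `s_p … s_0 . t_1 … t_q`,
with a minus sign in front if `neg` is true, and
`d = ± (∑_{i ≤ p} s_i 2^i + ∑_{1 ≤ j ≤ q} t_j 2^{-j})`. -/
def RepresentsDyadic (v : List DyadicSymbol) (d : ℝ) : Prop :=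
  ∃ (neg : Bool) (s t : List (Fin 2)), s ≠ [] ∧
    v = (if neg then [DyadicSymbol.minus] else []) ++ s.map DyadicSymbol.digit ++
      [DyadicSymbol.point] ++ t.map DyadicSymbol.digit ∧
    d = (if neg then -1 else 1) *
      ((Nat.ofDigits 2 (s.reverse.map Fin.val) : ℝ) + ∑ j : Fin t.length, ((t.get j : ℕ) : ℝ) / 2 ^ ((j : ℕ) + 1))

/-- `x ∈ SPACE_ℝ(f(n))`: some Turing machine outputs, for every `n`, on the unary input `0^n` a
representation of a dyadic number `d` with `|d - x| ≤ 2^{-n}`, and uses `O(f(n))` work tape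
cells. -/
def RealInSpace (f : ℕ → ℝ) (x : ℝ) : Prop :=
  ∃ (M : MultitapeTM Unit DyadicSymbol) (s : ℕ → ℕ),
    (∀ n : ℕ, ∃ (v : List DyadicSymbol) (d : ℝ),
      M.Outputs (List.replicate n ()) v ∧ RepresentsDyadic v d ∧ |d - x| ≤ (2 ^ n)⁻¹ ∧
      M.spaceUsed (List.replicate n ()) ≤ (s n : ℕ∞)) ∧
    (fun n : ℕ => (s n : ℝ)) =O[atTop] f

/-- A real number is computable in logspace if it is in `SPACE_ℝ(log n)`. -/
def LogspaceComputable (x : ℝ) : Prop :=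
  RealInSpace (fun n : ℕ => Real.log n) x

/-- A deterministic finite automaton with output: input alphabet `α`, outputs in `β`. -/
structure FiniteAutomatonWithOutput (α β : Type) where
  Q : Type
  finite_Q : Finite Q
  start : Q
  step : Q → α → Q
  out : Q → β

/-- The output of the automaton after reading the word `w` from left to right. -/
def FiniteAutomatonWithOutput.eval {α β : Type} (A : FiniteAutomatonWithOutput α β)
    (w : List α) : β :=
  A.out (w.foldl A.step A.start)

/-- The word `w = w_r ⋯ w_0` over `{0, …, k - 1}` is the radix-`k` expansion of `n`: most
significant digit first and without leading zeros. The expansion of `0` is the empty word. -/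
def IsRadixExpansion (k n : ℕ) (w : List (Fin k)) : Prop :=
  w.map Fin.val = (Nat.digits k n).reverse

/-- `x` is `(k,b)`-automatic: `x = a_0 + ∑_{i ≥ 1} a_i b^{-i}` with an integer `a_0` and base-`b`
digits `a_1, a_2, …`, where a finite automaton reads `n` in radix `k` and outputs `a_n`. -/
def IsAutomaticReal (k b : ℕ) (x : ℝ) : Prop :=
  ∃ (a : ℕ → ℤ) (A : FiniteAutomatonWithOutput (Fin k) ℤ),
    (∀ n : ℕ, ∀ w : List (Fin k), IsRadixExpansion k n w → A.eval w = a n) ∧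
    (∀ i : ℕ, 1 ≤ i → 0 ≤ a i ∧ a i < (b : ℤ)) ∧
    HasSum (fun i : ℕ => (a (i + 1) : ℝ) / (b : ℝ) ^ (i + 1)) (x - (a 0 : ℝ))

/-!
An automatic real has digits that are computable in logarithmic space, and the point is to convert
them from base `b` to base `2` without ever storing a number with more than `O(log n)` bits.

*The arithmetic.* Let `M` be the number of base-`b` digits that matter. The primes larger than `b`
and below a polynomial bound `K` are divided into groups of `w` primes; let `P l` be the product of
group `l`. By Chebyshev's bound (`le_primeCounting`) there are `M` complete groups. Then
`⌊P l / b⌋ / P l` differs from `1 / b` by at most `2 ^ (-w)`, so `∏ l < i, ⌊P l / b⌋ / P l` is a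
good approximation of `b ^ (-i)` (`approx_bounds`). Its denominator is a product of *distinct small*
primes, so that modulo `1` it is a sum of fractions `c / p` with `p < K` (`exists_int_sum_coef`).
The numerators `c` are determined by products modulo `p` and are found by exhaustive search, and the
binary digits of each `c / p` come from long division. The digits of all these fractions are added
column by column; only the current carry is stored. Starting with a carry that bounds the total
rounding error makes the result an upper bound, and the sum modulo `1` does not wrap around because
the exact value keeps a distance `b ^ (-M)` from `1` (`value_bounds`). The carry propagates from
the least significant column upwards, while the output starts with the most significant digit;
therefore each digit is computed from scratch (`outDigit_approximates`).

*The machine model.* Everything above is a function of natural numbers whose intermediate values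
are bounded by a polynomial in `n`. `PolyReg` is the class of functions computed by programs all of
whose registers stay polynomially bounded. It is closed under composition and under recursion with
polynomially bounded values (`PolyReg.natRec`), and therefore contains arithmetic, bounded sums,
products modulo a number, and automatic sequences (`PolyReg.automatic`). A register is a binary
counter on a work tape, which occupies `O(log n)` cells. Programs are written in a small structured
language (`Cmd`); its commands are compiled to a Turing machine whose control states are the
finitely many stacks of pending commands (`exists_machine`). A program that prints the digits one
after the other (`exists_printer`) then gives the theorem.
-/

/-! ### A structured language for Turing machines -/

namespace StructuredTM

/-- Tape symbols; `none` is the blank. -/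
abbrev Sym := Option Bool

/-- Elementary actions: write a symbol on tape `j`, move the head of tape `j`, append a symbol to
the output, move the input head to the right. Work tapes are indexed by `ℕ`; a command mentions
only finitely many. -/
inductive Atom where
  | write (j : ℕ) (γ : Sym) : Atom
  | move (j : ℕ) (d : HeadMove) : Atom
  | emit (o : DyadicSymbol) : Atom
  | next : Atom

/-- Conditions on the scanned symbols: a property of the symbol scanned on tape `j`, or the
condition that the scanned input cell is not blank. -/
inductive Test where
  | tape (j : ℕ) (f : Sym → Bool) : Test
  | input : Test

/-- Structured programs acting on the tapes of a Turing machine; `loop t p` repeats `p` while `t`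
holds. -/
inductive Cmd where
  | skip : Cmd
  | act (a : Atom) : Cmd
  | seq (p q : Cmd) : Cmd
  | ite (t : Test) (p q : Cmd) : Cmd
  | loop (t : Test) (p : Cmd) : Cmd

/-- The data part of a configuration: everything except the control state. -/
@[ext]
structure Mem where
  pos : ℕ
  work : ℕ → ℤ → Sym
  head : ℕ → ℤ
  out : List DyadicSymbol

/-- The memory at the start of a computation. -/
def Mem.init : Mem := ⟨1, fun _ _ => none, fun _ => 0, []⟩

/-- Effect of an elementary action; `n` is the length of the input. -/
def Atom.apply (n : ℕ) (μ : Mem) : Atom → Mem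
  | .write j γ =>
    { μ with
      work := Function.update μ.work j (Function.update (μ.work j) (μ.head j) γ) }
  | .move j d =>
    { μ with
      head := Function.update μ.head j (MultitapeTM.moveHead (μ.head j) d) }
  | .emit o => { μ with out := μ.out ++ [o] }
  | .next => { μ with pos := min (μ.pos + 1) (n + 1) }

/-- The truth value of a condition; `n` is the length of the input. -/
def Test.eval (n : ℕ) (μ : Mem) : Test → Bool
  | .tape j f => f (μ.work j (μ.head j))
  | .input => (MultitapeTM.readInput (List.replicate n ()) μ.pos).isSome

/-- All work heads are in the window `-1, …, B`. -/
def Mem.InWindow (B : ℕ) (μ : Mem) : Prop := ∀ j, μ.head j ∈ Set.Icc (-1 : ℤ) B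

/-- Big-step semantics on an input of length `n`. Only executions during which every head stays in
the window `-1, …, B` are recorded; cell `-1` is visited when a head looks for the left end of the
number on its tape. -/
inductive Exec (n B : ℕ) : Cmd → Mem → Mem → Prop
  | skip (μ) : Exec n B .skip μ μ
  | act (a μ) (h : (a.apply n μ).InWindow B) : Exec n B (.act a) μ (a.apply n μ)
  | seq {p q μ μ' μ''} (h₁ : Exec n B p μ μ') (h₂ : Exec n B q μ' μ'') :
      Exec n B (.seq p q) μ μ''
  | iteTrue {t p q μ μ'} (ht : t.eval n μ = true) (h : Exec n B p μ μ') :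
      Exec n B (.ite t p q) μ μ'
  | iteFalse {t p q μ μ'} (ht : t.eval n μ = false) (h : Exec n B q μ μ') :
      Exec n B (.ite t p q) μ μ'
  | loopDone {t p μ} (ht : t.eval n μ = false) : Exec n B (.loop t p) μ μ
  | loopStep {t p μ μ' μ''} (ht : t.eval n μ = true) (h₁ : Exec n B p μ μ')
      (h₂ : Exec n B (.loop t p) μ' μ'') : Exec n B (.loop t p) μ μ''

theorem Exec.inWindow {n B : ℕ} {p : Cmd} {μ μ' : Mem} (h : Exec n B p μ μ') :
    μ.InWindow B → μ'.InWindow B := by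
  induction h with
  | skip => exact id
  | act a μ h => exact fun _ => h
  | seq _ _ ih₁ ih₂ => exact fun h => ih₂ (ih₁ h)
  | iteTrue _ _ ih => exact ih
  | iteFalse _ _ ih => exact ih
  | loopDone => exact id
  | loopStep _ _ _ ih₁ ih₂ => exact fun h => ih₂ (ih₁ h)

/-! ### Compilation to multitape Turing machines -/

/-- The tapes mentioned in the action have an index below this number. -/
def Atom.bound : Atom → ℕ
  | .write j _ => j + 1
  | .move j _ => j + 1
  | _ => 0

/-- The tapes mentioned in the condition have an index below this number. -/
def Test.bound : Test → ℕ
  | .tape j _ => j + 1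
  | .input => 0

/-- All tapes mentioned in the command have an index below this number. -/
def Cmd.bound : Cmd → ℕ
  | .skip => 0
  | .act a => a.bound
  | .seq p q => max p.bound q.bound
  | .ite t p q => max t.bound (max p.bound q.bound)
  | .loop t p => max t.bound p.bound

/-- The control states of the compiled machine are stacks of commands still to be executed. This is
the (finite) set of stacks that occur while `p` is executed on top of `K`. -/
def Cmd.conts : Cmd → List Cmd → Set (List Cmd)
  | .skip, K => {.skip :: K, K}
  | .act a, K => {.act a :: K, K}
  | .seq p q, K => insert (.seq p q :: K) (p.conts (q :: K) ∪ q.conts K)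
  | .ite t p q, K => insert (.ite t p q :: K) (p.conts K ∪ q.conts K)
  | .loop t p, K => insert (.loop t p :: K) (insert K (p.conts (.loop t p :: K)))

theorem Cmd.conts_finite (p : Cmd) : ∀ K, (p.conts K).Finite := by
  induction p with
  | skip => intro K; simp [conts]
  | act a => intro K; simp [conts]
  | seq p q ihp ihq => intro K; exact ((ihp _).union (ihq _)).insert _
  | ite t p q ihp ihq => intro K; exact ((ihp _).union (ihq _)).insert _
  | loop t p ih => intro K; exact ((ih _).insert _).insert _

theorem Cmd.cons_mem_conts (p : Cmd) (K : List Cmd) : p :: K ∈ p.conts K := by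
  cases p <;> simp [conts]

theorem Cmd.mem_conts (p : Cmd) : ∀ K, K ∈ p.conts K := by
  induction p with
  | skip => intro K; simp [conts]
  | act a => intro K; simp [conts]
  | seq p q _ ihq => intro K; exact Or.inr (Or.inr (ihq K))
  | ite t p q _ ihq => intro K; exact Or.inr (Or.inr (ihq K))
  | loop t p _ => intro K; exact Or.inr (Or.inl rfl)

section compile

variable (S : Set (List Cmd)) (m : ℕ)

/-- A stack as a control state; the value on stacks outside `S` is irrelevant. -/
noncomputable def toState [Nonempty S] (K : List Cmd) : S :=
  open Classical in if h : K ∈ S then ⟨K, h⟩ else Classical.arbitrary S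

theorem toState_val [Nonempty S] {K : List Cmd} (h : K ∈ S) : (toState S K).1 = K := by
  simp [toState, h]

/-- The action of the machine that only changes the control state; `g` are the scanned symbols. -/
def idle {Q : Type} (g : Fin m → Sym) (s : Q) : TMAction DyadicSymbol Q Sym m :=
  ⟨s, .stay, g, fun _ => .stay, none⟩

/-- An elementary action as an action of the machine with `m` work tapes. -/
def Atom.toAction {Q : Type} (g : Fin m → Sym) (s : Q) :
    Atom → TMAction DyadicSymbol Q Sym m
  | .write j γ => { idle m g s with write := fun i => if i.1 = j then γ else g i }
  | .move j d => { idle m g s with move := fun i => if i.1 = j then d else .stay }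
  | .emit o => { idle m g s with emit := some o }
  | .next => { idle m g s with inputMove := .right }

/-- The truth value of a condition, given the scanned input symbol `i` and the symbols `g` scanned
on the `m` work tapes. -/
def Test.decide (i : Option Unit) (g : Fin m → Sym) : Test → Bool
  | .tape j f => if h : j < m then f (g ⟨j, h⟩) else false
  | .input => i.isSome

/-- The machine that executes `p`, with the stacks in `S` as control states. It halts when the stack
is empty. -/
noncomputable def machine (hS : S.Finite) [Nonempty S] (p : Cmd) :
    MultitapeTM Unit DyadicSymbol where
  Q := S
  finite_Q := hS.to_subtype
  Γ := Sym
  finite_Γ := inferInstance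
  blank := none
  tapes := m
  start := toState S [p]
  trans s i g :=
    match s.1 with
    | [] => none
    | .skip :: K => some (idle m g (toState S K))
    | .act a :: K => some (a.toAction m g (toState S K))
    | .seq p q :: K => some (idle m g (toState S (p :: q :: K)))
    | .ite t p q :: K => some (idle m g (toState S ((if t.decide m i g then p else q) :: K)))
    | .loop t p :: K =>
      some (idle m g (toState S (if t.decide m i g then p :: .loop t p :: K else K)))

variable {S m} (hS : S.Finite) [Nonempty S] (p₀ : Cmd)

/-- The configuration of the compiled machine with stack `K` and memory `μ`. -/
noncomputable def cfgOf (K : List Cmd) (μ : Mem) : (machine S m hS p₀).Cfg where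
  state := toState S K
  inputPos := μ.pos
  work := fun j : Fin m => μ.work j
  head := fun j : Fin m => μ.head j
  output := μ.out

theorem Test.decide_eq (n : ℕ) (μ : Mem) (t : Test) (ht : t.bound ≤ m) :
    t.decide m (MultitapeTM.readInput (List.replicate n ()) μ.pos)
      (fun j : Fin m => μ.work j (μ.head j)) = t.eval n μ := by
  cases t with
  | tape j f =>
    have : j < m := ht
    simp [Test.decide, Test.eval, this]
  | input => rfl

theorem step_idle (n : ℕ) {K K' : List Cmd} (μ : Mem)
    (h : (machine S m hS p₀).action (List.replicate n ()) (cfgOf hS p₀ K μ) =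
      some (idle m (fun j : Fin m => μ.work j (μ.head j)) (toState S K'))) :
    (machine S m hS p₀).step (List.replicate n ()) (cfgOf hS p₀ K μ) = cfgOf hS p₀ K' μ := by
  rw [MultitapeTM.step, h]
  simp only [idle, cfgOf, MultitapeTM.moveInput, MultitapeTM.moveHead, Option.toList,
    List.append_nil]
  congr 1
  exact funext fun i : Fin m => Function.update_eq_self _ _

theorem step_atom (n : ℕ) {K K' : List Cmd} (μ : Mem) (a : Atom) (ha : a.bound ≤ m)
    (h : (machine S m hS p₀).action (List.replicate n ()) (cfgOf hS p₀ K μ) =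
      some (a.toAction m (fun j : Fin m => μ.work j (μ.head j)) (toState S K'))) :
    (machine S m hS p₀).step (List.replicate n ()) (cfgOf hS p₀ K μ) =
      cfgOf hS p₀ K' (a.apply n μ) := by
  rw [MultitapeTM.step, h]
  cases a with
  | write j γ =>
    simp only [Atom.toAction, idle, cfgOf, MultitapeTM.moveInput, MultitapeTM.moveHead,
      Atom.apply, Option.toList, List.append_nil]
    congr 1
    refine funext fun i : Fin m => ?_
    by_cases hi : i.1 = j
    · subst hi; simp only [if_true, Function.update_self]; rfl
    · simp only [if_neg hi, Function.update_of_ne hi]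
      exact Function.update_eq_self _ _
  | move j d =>
    simp only [Atom.toAction, idle, cfgOf, MultitapeTM.moveInput,
      Atom.apply, Option.toList, List.append_nil]
    congr 1
    · exact funext fun i : Fin m => Function.update_eq_self _ _
    refine funext fun i : Fin m => ?_
    by_cases hi : i.1 = j
    · subst hi; simp only [if_true, Function.update_self]
    · simp only [if_neg hi, Function.update_of_ne hi, MultitapeTM.moveHead]
  | emit o =>
    simp only [Atom.toAction, idle, cfgOf, MultitapeTM.moveInput, MultitapeTM.moveHead, Atom.apply,
      Option.toList]
    congr 1
    exact funext fun i : Fin m => Function.update_eq_self _ _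
  | next =>
    simp only [Atom.toAction, idle, cfgOf, MultitapeTM.moveInput, MultitapeTM.moveHead, Atom.apply,
      Option.toList, List.append_nil, List.length_replicate]
    congr 1
    exact funext fun i : Fin m => Function.update_eq_self _ _

/-- `c'` is reached from `c` by a computation during which all heads are in the window. -/
def Reaches {M : MultitapeTM Unit DyadicSymbol} (n B : ℕ) (c c' : M.Cfg) : Prop :=
  ∃ τ : ℕ, (M.step (List.replicate n ()))^[τ] c = c' ∧
    ∀ σ ≤ τ, ∀ j, ((M.step (List.replicate n ()))^[σ] c).head j ∈ Set.Icc (-1 : ℤ) B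

theorem Reaches.trans {M : MultitapeTM Unit DyadicSymbol} {n B : ℕ} {c c' c'' : M.Cfg}
    (h : Reaches n B c c') (h' : Reaches n B c' c'') : Reaches n B c c'' := by
  obtain ⟨τ, h₁, h₂⟩ := h
  obtain ⟨τ', h₁', h₂'⟩ := h'
  refine ⟨τ' + τ, by rw [Function.iterate_add_apply, h₁, h₁'], fun σ hσ j => ?_⟩
  rcases le_or_gt σ τ with h | h
  · exact h₂ σ h j
  · obtain ⟨ρ, rfl⟩ := Nat.exists_eq_add_of_lt h
    rw [show τ + ρ + 1 = (ρ + 1) + τ by omega, Function.iterate_add_apply, h₁]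
    exact h₂' _ (by omega) j

theorem Reaches.single {M : MultitapeTM Unit DyadicSymbol} {n B : ℕ} {c c' : M.Cfg}
    (h : M.step (List.replicate n ()) c = c')
    (hc : ∀ j, c.head j ∈ Set.Icc (-1 : ℤ) B) (hc' : ∀ j, c'.head j ∈ Set.Icc (-1 : ℤ) B) :
    Reaches n B c c' := by
  refine ⟨1, by simpa using h, fun σ hσ j => ?_⟩
  interval_cases σ
  · exact hc j
  · simpa [h] using hc' j

/-- The compiled machine simulates the big-step semantics. -/
theorem Exec.reaches {n B : ℕ} {p : Cmd} {μ μ' : Mem} (h : Exec n B p μ μ') :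
    ∀ K, p.bound ≤ m → p.conts K ⊆ S → μ.InWindow B →
      Reaches n B (cfgOf (m := m) hS p₀ (p :: K) μ) (cfgOf hS p₀ K μ') := by
  have step : ∀ {K K' : List Cmd} {μ : Mem}, μ.InWindow B →
      (machine S m hS p₀).action (List.replicate n ()) (cfgOf hS p₀ K μ) =
        some (idle m (fun j : Fin m => μ.work j (μ.head j)) (toState S K')) →
      Reaches n B (cfgOf (m := m) hS p₀ K μ) (cfgOf hS p₀ K' μ) := fun hμ h =>
    Reaches.single (step_idle hS p₀ n _ h) (fun j => hμ j.1) (fun j => hμ j.1)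
  have hact : ∀ {p : Cmd} {K : List Cmd} {μ : Mem}, p.conts K ⊆ S →
      ((cfgOf (m := m) hS p₀ (p :: K) μ).state : S).1 = p :: K := fun {p K μ} h =>
    toState_val S (h (p.cons_mem_conts K))
  induction h with
  | skip μ =>
    intro K _ hK hμ
    refine step hμ ?_
    simp only [MultitapeTM.action, machine]
    rw [hact hK]
    rfl
  | act a μ h =>
    intro K hm hK hμ
    refine Reaches.single (step_atom hS p₀ n μ a hm ?_) (fun j => hμ j.1) (fun j => h j.1)
    simp only [MultitapeTM.action, machine]
    rw [hact hK]
    rfl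
  | @seq p q μ μ' μ'' h₁ h₂ ih₁ ih₂ =>
    intro K hm hK hμ
    have hp : p.conts (q :: K) ⊆ S := fun x hx => hK (Or.inr (Or.inl hx))
    have hq : q.conts K ⊆ S := fun x hx => hK (Or.inr (Or.inr hx))
    refine Reaches.trans (step (K' := p :: q :: K) hμ ?_)
      ((ih₁ _ ((le_max_left _ _).trans hm) hp hμ).trans
        (ih₂ _ ((le_max_right _ _).trans hm) hq (h₁.inWindow hμ)))
    simp only [MultitapeTM.action, machine]
    rw [hact hK]
    rfl
  | @iteTrue t p q μ μ' ht h ih =>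
    intro K hm hK hμ
    simp only [Cmd.bound, max_le_iff] at hm
    have hp : p.conts K ⊆ S := fun x hx => hK (Or.inr (Or.inl hx))
    refine Reaches.trans (step (K' := p :: K) hμ ?_) (ih _ hm.2.1 hp hμ)
    simp only [MultitapeTM.action, machine]
    rw [hact hK]
    have := Test.decide_eq n μ t hm.1
    simp only [cfgOf, this, ht]
    rfl
  | @iteFalse t p q μ μ' ht h ih =>
    intro K hm hK hμ
    simp only [Cmd.bound, max_le_iff] at hm
    have hq : q.conts K ⊆ S := fun x hx => hK (Or.inr (Or.inr hx))
    refine Reaches.trans (step (K' := q :: K) hμ ?_) (ih _ hm.2.2 hq hμ)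
    simp only [MultitapeTM.action, machine]
    rw [hact hK]
    have := Test.decide_eq n μ t hm.1
    simp only [cfgOf, this, ht]
    rfl
  | @loopDone t p μ ht =>
    intro K hm hK hμ
    simp only [Cmd.bound, max_le_iff] at hm
    refine step hμ ?_
    simp only [MultitapeTM.action, machine]
    rw [hact hK]
    have := Test.decide_eq n μ t hm.1
    simp only [cfgOf, this, ht]
    rfl
  | @loopStep t p μ μ' μ'' ht h₁ h₂ ih₁ ih₂ =>
    intro K hm hK hμ
    have hm' := hm
    simp only [Cmd.bound, max_le_iff] at hm
    have hp : p.conts (.loop t p :: K) ⊆ S := fun x hx => hK (Or.inr (Or.inr hx))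
    refine Reaches.trans (step (K' := p :: .loop t p :: K) hμ ?_)
      ((ih₁ _ hm.2 hp hμ).trans (ih₂ _ hm' hK (h₁.inWindow hμ)))
    simp only [MultitapeTM.action, machine]
    rw [hact hK]
    have := Test.decide_eq n μ t hm.1
    simp only [cfgOf, this, ht]
    rfl

end compile

/-- Every structured program is realized by a Turing machine which, as long as all heads of the
program stay in the window `-1, …, B`, scans at most `B + 2` cells of each tape. -/
theorem exists_machine (p : Cmd) : ∃ M : MultitapeTM Unit DyadicSymbol, ∀ (n B : ℕ) (μ : Mem),
    Exec n B p .init μ → M.Outputs (List.replicate n ()) μ.out ∧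
      M.spaceUsed (List.replicate n ()) ≤ ((p.bound * (B + 2) : ℕ) : ℕ∞) := by
  set S := p.conts [] with hSdef
  have hS : S.Finite := p.conts_finite []
  have : Nonempty S := ⟨⟨[], p.mem_conts []⟩⟩
  refine ⟨machine S p.bound hS p, fun n B μ h => ?_⟩
  set M := machine S p.bound hS p with hM
  obtain ⟨τ, hτ, hwin⟩ := h.reaches hS p [] le_rfl subset_rfl (fun j => by simp [Mem.init])
  have hinit : M.init = cfgOf hS p [p] Mem.init := rfl
  have hcfg : M.cfgAt (List.replicate n ()) τ = cfgOf hS p [] μ := by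
    rw [MultitapeTM.cfgAt, hinit, hτ]
  have hhalt : M.action (List.replicate n ()) (cfgOf hS p [] μ) = none := by
    show (machine S p.bound hS p).action _ _ = none
    simp only [MultitapeTM.action, machine]
    have : ((cfgOf (m := p.bound) hS p [] μ).state : S).1 = [] := toState_val S (p.mem_conts [])
    rw [this]
  have hafter : ∀ σ, M.cfgAt (List.replicate n ()) (σ + τ) = cfgOf hS p [] μ := by
    intro σ
    rw [MultitapeTM.cfgAt, Function.iterate_add_apply, ← MultitapeTM.cfgAt, hcfg]
    exact Function.iterate_fixed (by rw [MultitapeTM.step, hhalt]) σ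
  refine ⟨⟨τ, by rw [hcfg, hhalt], by rw [hcfg]; rfl⟩, ?_⟩
  have hall : ∀ σ j, (M.cfgAt (List.replicate n ()) σ).head j ∈ Set.Icc (-1 : ℤ) B := by
    intro σ j
    rcases le_or_gt σ τ with hσ | hσ
    · exact hwin σ hσ j
    · have := hafter (σ - τ)
      rw [Nat.sub_add_cancel hσ.le] at this
      rw [this, ← hcfg]
      exact hwin τ le_rfl j
  have hsub : {c : Fin M.tapes × ℤ | ∃ σ, (M.cfgAt (List.replicate n ()) σ).head c.1 = c.2} ⊆
      ((Finset.univ ×ˢ Finset.Icc (-1 : ℤ) B : Finset (Fin M.tapes × ℤ)) :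
        Set (Fin M.tapes × ℤ)) := by
    rintro ⟨j, z⟩ ⟨σ, h⟩
    have := hall σ j
    rw [show _ = z from h] at this
    simpa using this
  refine (Set.encard_le_encard hsub).trans ?_
  rw [Set.encard_coe_eq_coe_finsetCard, Finset.card_product, Finset.card_univ, Fintype.card_fin,
    Int.card_Icc]
  have : ((B : ℤ) + 1 - -1).toNat = B + 2 := by omega
  rw [this]
  exact le_rfl

end StructuredTM

/-! ### Binary counters on work tapes -/

namespace StructuredTM

variable {n B : ℕ}

/-- The tape holding the number `v`: the binary digits of `v`, least significant first and without
leading zeros, on the cells `0, 1, …`; all other cells are blank. So `v = 0` exactly if cell `0` is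
blank. -/
def encode (v : ℕ) : ℤ → Sym
  | .ofNat i => (Nat.bits v)[i]?
  | .negSucc _ => none

/-- Replace the content of tape `j` by `T` and move its head to `h`. -/
def Mem.tape (μ : Mem) (j : ℕ) (T : ℤ → Sym) (h : ℤ) : Mem :=
  { μ with
    work := Function.update μ.work j T
    head := Function.update μ.head j h }

theorem Mem.InWindow.tape {μ : Mem} (hμ : μ.InWindow B) {j : ℕ} {T : ℤ → Sym} {h : ℤ}
    (hh : h ∈ Set.Icc (-1 : ℤ) B) : (μ.tape j T h).InWindow B := by
  intro i
  by_cases hi : i = j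
  · subst hi; simpa [Mem.tape] using hh
  · simpa [Mem.tape, hi] using hμ i

theorem Exec.write {μ : Mem} (hμ : μ.InWindow B) (j : ℕ) (T : ℤ → Sym) (γ : Sym) {h : ℤ}
    (hh : h ∈ Set.Icc (-1 : ℤ) B) :
    Exec n B (.act (.write j γ)) (μ.tape j T h) (μ.tape j (Function.update T h γ) h) := by
  have e : Atom.apply n (μ.tape j T h) (.write j γ) = μ.tape j (Function.update T h γ) h := by
    simp [Atom.apply, Mem.tape]
  rw [← e]
  exact Exec.act _ _ (by rw [e]; exact hμ.tape hh)

theorem Exec.move {μ : Mem} (hμ : μ.InWindow B) (j : ℕ) (T : ℤ → Sym) (d : HeadMove) {h : ℤ}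
    (hh : MultitapeTM.moveHead h d ∈ Set.Icc (-1 : ℤ) B) :
    Exec n B (.act (.move j d)) (μ.tape j T h) (μ.tape j T (MultitapeTM.moveHead h d)) := by
  have e : Atom.apply n (μ.tape j T h) (.move j d) =
      μ.tape j T (MultitapeTM.moveHead h d) := by
    simp [Atom.apply, Mem.tape]
  rw [← e]
  exact Exec.act _ _ (by rw [e]; exact hμ.tape hh)

theorem eval_tape (μ : Mem) (j : ℕ) (f : Sym → Bool) (T : ℤ → Sym) (h : ℤ) :
    (Test.tape j f).eval n (μ.tape j T h) = f (T h) := by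
  simp [Test.eval, Mem.tape]

/-- Return to cell `0` of a tape whose cell `-1` is blank. -/
def Cmd.home (j : ℕ) : Cmd :=
  .seq (.act (.move j .left)) (.seq (.loop (.tape j Option.isSome) (.act (.move j .left)))
    (.act (.move j .right)))

theorem Exec.home {μ : Mem} (hμ : μ.InWindow B) (j : ℕ) (T : ℤ → Sym) (k : ℕ) (hk : k ≤ B)
    (hT : ∀ i < k, (T i).isSome = true) (hT' : T (-1) = none) :
    Exec n B (.home j) (μ.tape j T k) (μ.tape j T 0) := by
  have hloop : ∀ k : ℕ, k ≤ B → (∀ i < k, (T i).isSome = true) →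
      Exec n B (.loop (.tape j Option.isSome) (.act (.move j .left)))
        (μ.tape j T ((k : ℤ) - 1)) (μ.tape j T (-1)) := by
    intro k
    induction k with
    | zero => exact fun _ _ => Exec.loopDone (by simp [eval_tape, hT'])
    | succ k ih =>
      intro hk hT
      refine Exec.loopStep (by simpa [eval_tape] using hT k (by omega))
        (Exec.move hμ j T .left (by simp [MultitapeTM.moveHead]; omega)) ?_
      simpa [MultitapeTM.moveHead] using ih (by omega) fun i hi => hT i (by omega)
  refine Exec.seq (Exec.move hμ j T .left (by simp [MultitapeTM.moveHead]; omega))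
    (Exec.seq (hloop k hk hT) ?_)
  exact Exec.move hμ j T .right (by simp [MultitapeTM.moveHead])

/-- Successor on binary expansions, least significant digit first. -/
def succDigits : List Bool → List Bool
  | [] => [true]
  | false :: l => true :: l
  | true :: l => false :: succDigits l

/-- Predecessor on binary expansions without leading zeros, least significant digit first. -/
def predDigits : List Bool → List Bool
  | [] => []
  | false :: l => true :: predDigits l
  | [true] => []
  | true :: d :: l => false :: d :: l

theorem bits_succ (v : ℕ) : Nat.bits (v + 1) = succDigits (Nat.bits v) := by
  induction v using Nat.binaryRec' with
  | zero => simp [succDigits]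
  | bit c v h ih =>
    rw [Nat.bits_append_bit _ _ h]
    cases c with
    | false =>
      rw [show Nat.bit false v + 1 = Nat.bit true v by simp [Nat.bit],
        Nat.bits_append_bit _ _ (by simp)]
      rfl
    | true =>
      rw [show Nat.bit true v + 1 = Nat.bit false (v + 1) by simp [Nat.bit]; ring,
        Nat.bits_append_bit _ _ (by simp), ih]
      rfl

theorem bits_pred (v : ℕ) : predDigits (Nat.bits (v + 1)) = Nat.bits v := by
  rw [bits_succ]
  induction v using Nat.binaryRec' with
  | zero => simp [succDigits, predDigits]
  | bit c v h ih =>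
    rw [Nat.bits_append_bit _ _ h]
    cases c with
    | false =>
      have hv : v ≠ 0 := fun h0 => by simpa using h h0
      obtain ⟨w, rfl⟩ := Nat.exists_eq_succ_of_ne_zero hv
      have : Nat.bits (w + 1) ≠ [] := by
        rw [bits_succ]; cases Nat.bits w with
        | nil => simp [succDigits]
        | cons d l => cases d <;> simp [succDigits]
      obtain ⟨d, l, hl⟩ := List.exists_cons_of_ne_nil this
      simp [hl, succDigits, predDigits]
    | true => simp [succDigits, predDigits, ih]

/-- Increment the number on tape `j`. -/
def Cmd.inc (j : ℕ) : Cmd :=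
  .seq (.seq (.loop (.tape j (· == some true))
      (.seq (.act (.write j (some false))) (.act (.move j .right))))
    (.act (.write j (some true)))) (.home j)

/-- Decrement the nonzero number on tape `j`. The last leading digit is erased if it becomes
zero. -/
def Cmd.dec (j : ℕ) : Cmd :=
  .seq (.seq (.loop (.tape j (· == some false))
      (.seq (.act (.write j (some true))) (.act (.move j .right))))
    (.seq (.act (.move j .right)) (.ite (.tape j Option.isSome)
      (.seq (.act (.move j .left)) (.act (.write j (some false))))
      (.seq (.act (.move j .left)) (.act (.write j none)))))) (.home j)

/-- The carry propagation of an increment: the head moves from the least significant digit, in cell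
`h`, to the first zero or blank. -/
theorem Exec.inc_forward {μ : Mem} (hμ : μ.InWindow B) (j : ℕ) (l : List Bool) :
    ∀ (T : ℤ → Sym) (h : ℕ), (∀ i : ℕ, T (h + i : ℕ) = l[i]?) → h + (succDigits l).length ≤ B →
    ∃ (T' : ℤ → Sym) (h' : ℕ), Exec n B
      (.seq (.loop (.tape j (· == some true))
        (.seq (.act (.write j (some false))) (.act (.move j .right))))
        (.act (.write j (some true)))) (μ.tape j T h) (μ.tape j T' h') ∧
      (∀ z < (h : ℤ), T' z = T z) ∧ (∀ i : ℕ, T' (h + i : ℕ) = (succDigits l)[i]?) ∧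
      h ≤ h' ∧ h' < h + (succDigits l).length := by
  have base : ∀ (l l' : List Bool) (T : ℤ → Sym) (h : ℕ), (∀ i : ℕ, T (h + i : ℕ) = l[i]?) →
      h + l'.length ≤ B → 0 < l'.length → l'.head? = some true → l'.tail = l.tail →
      l.head? ≠ some true →
      ∃ (T' : ℤ → Sym) (h' : ℕ), Exec n B
        (.seq (.loop (.tape j (· == some true))
          (.seq (.act (.write j (some false))) (.act (.move j .right))))
          (.act (.write j (some true)))) (μ.tape j T h) (μ.tape j T' h') ∧
        (∀ z < (h : ℤ), T' z = T z) ∧ (∀ i : ℕ, T' (h + i : ℕ) = l'[i]?) ∧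
        h ≤ h' ∧ h' < h + l'.length := by
    intro l l' T h hT hB hpos hhead htail hl
    refine ⟨Function.update T h (some true), h, Exec.seq (Exec.loopDone ?_)
      (Exec.write hμ j T _ ⟨by omega, by omega⟩), fun z hz => ?_, fun i => ?_, le_rfl, by omega⟩
    · have := hT 0
      simp only [add_zero, ← List.head?_eq_getElem?] at this
      simpa [eval_tape, this] using hl
    · simp [hz.ne]
    · cases i with
      | zero => simp [← hhead, List.head?_eq_getElem?]
      | succ i =>
        rw [Function.update_of_ne (by push_cast; omega), hT, ← List.getElem?_tail, ← htail,
          List.getElem?_tail]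
  induction l with
  | nil => exact fun T h hT hB => base _ _ T h hT hB (by simp [succDigits]) rfl rfl (by simp)
  | cons d l ih =>
    intro T h hT hB
    cases d with
    | false => exact base _ _ T h hT hB (by simp [succDigits]) rfl rfl (by simp)
    | true =>
      have hB' : h + (succDigits l).length + 1 ≤ B := by simpa [succDigits, add_assoc] using hB
      obtain ⟨T', h', hex, hlt, heq, hle, hlt'⟩ := ih (Function.update T h (some false)) (h + 1)
        (fun i => by
          rw [Function.update_of_ne (by push_cast; omega), add_assoc, add_comm 1 i, hT]
          simp) (by omega)
      cases hex with
      | seq h₁ h₂ =>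
      refine ⟨T', h', Exec.seq (Exec.loopStep ?_ (Exec.seq (Exec.write hμ j T _ ?_)
        (Exec.move hμ j _ .right ?_)) h₁) h₂, fun z hz => ?_, fun i => ?_, by omega, ?_⟩
      · have := hT 0
        simp only [add_zero] at this
        simp [eval_tape, this]
      · constructor <;> omega
      · simp [MultitapeTM.moveHead]; omega
      · rw [hlt z (by push_cast; omega), Function.update_of_ne hz.ne]
      · cases i with
        | zero => rw [hlt _ (by push_cast; omega)]; simp [succDigits]
        | succ i =>
          rw [show h + (i + 1) = h + 1 + i by ring, heq]
          simp [succDigits]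
      · simp only [succDigits, List.length_cons]; omega

/-- The borrow propagation of a decrement: the head moves from the least significant digit, in cell
`h`, to the first digit `1`, which is erased if it is the leading digit and replaced by `0`
otherwise. -/
theorem Exec.dec_forward {μ : Mem} (hμ : μ.InWindow B) (j : ℕ) (l : List Bool) :
    ∀ (T : ℤ → Sym) (h : ℕ), (∀ i : ℕ, T (h + i : ℕ) = l[i]?) → h + l.length ≤ B → true ∈ l →
    ∃ (T' : ℤ → Sym) (h' : ℕ), Exec n B
      (.seq (.loop (.tape j (· == some false))
        (.seq (.act (.write j (some true))) (.act (.move j .right))))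
      (.seq (.act (.move j .right)) (.ite (.tape j Option.isSome)
        (.seq (.act (.move j .left)) (.act (.write j (some false))))
        (.seq (.act (.move j .left)) (.act (.write j none))))))
        (μ.tape j T h) (μ.tape j T' h') ∧
      (∀ z < (h : ℤ), T' z = T z) ∧ (∀ i : ℕ, T' (h + i : ℕ) = (predDigits l)[i]?) ∧
      h ≤ h' ∧ h' ≤ h + (predDigits l).length := by
  induction l with
  | nil => simp
  | cons d l ih =>
    intro T h hT hB hl
    rw [List.length_cons] at hB
    cases d with
    | true =>
      have h0 : T (h : ℤ) = some true := by simpa using hT 0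
      have h1 : T (h + 1 : ℤ) = l[0]? := by simpa using hT 1
      have hmr : MultitapeTM.moveHead (h : ℤ) .right = h + 1 := rfl
      have hml : MultitapeTM.moveHead (h + 1 : ℤ) .left = h := by simp [MultitapeTM.moveHead]
      have hright := Exec.move (n := n) (B := B) hμ j T .right (h := h)
        (by rw [hmr]; constructor <;> omega)
      have hleft := Exec.move (n := n) (B := B) hμ j T .left (h := h + 1)
        (by rw [hml]; constructor <;> omega)
      rw [hmr] at hright
      rw [hml] at hleft
      cases l with
      | nil =>
        refine ⟨Function.update T h none, h, Exec.seq (Exec.loopDone (by simp [eval_tape, h0]))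
          (Exec.seq hright (Exec.iteFalse (by simp [eval_tape, h1])
            (Exec.seq hleft (Exec.write hμ j T _ ⟨by omega, by omega⟩)))),
          fun z hz => by simp [hz.ne], fun i => ?_, le_rfl, by omega⟩
        cases i with
        | zero => simp [predDigits]
        | succ i => rw [Function.update_of_ne (by push_cast; omega), hT]; simp [predDigits]
      | cons d l =>
        refine ⟨Function.update T h (some false), h,
          Exec.seq (Exec.loopDone (by simp [eval_tape, h0]))
          (Exec.seq hright (Exec.iteTrue (by simp [eval_tape, h1])
            (Exec.seq hleft (Exec.write hμ j T _ ⟨by omega, by omega⟩)))),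
          fun z hz => by simp [hz.ne], fun i => ?_, le_rfl, by omega⟩
        cases i with
        | zero => simp [predDigits]
        | succ i => rw [Function.update_of_ne (by push_cast; omega), hT]; simp [predDigits]
    | false =>
      obtain ⟨T', h', hex, hlt, heq, hle, hlt'⟩ := ih (Function.update T h (some true)) (h + 1)
        (fun i => by
          rw [Function.update_of_ne (by push_cast; omega), add_assoc, add_comm 1 i, hT]
          simp) (by omega) (by simpa using hl)
      cases hex with
      | seq h₁ h₂ =>
      refine ⟨T', h', Exec.seq (Exec.loopStep ?_ (Exec.seq (Exec.write hμ j T _ ?_)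
        (Exec.move hμ j _ .right ?_)) h₁) h₂, fun z hz => ?_, fun i => ?_, by omega, ?_⟩
      · have := hT 0
        simp only [add_zero] at this
        simp [eval_tape, this]
      · constructor <;> omega
      · simp [MultitapeTM.moveHead]; omega
      · rw [hlt z (by push_cast; omega), Function.update_of_ne hz.ne]
      · cases i with
        | zero => rw [hlt _ (by push_cast; omega)]; simp [predDigits]
        | succ i =>
          rw [show h + (i + 1) = h + 1 + i by ring, heq]
          simp [predDigits]
      · simp only [predDigits, List.length_cons]; omega

theorem eq_encode {T : ℤ → Sym} {v : ℕ} (h₁ : ∀ z < (0 : ℤ), T z = none)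
    (h₂ : ∀ i : ℕ, T i = (Nat.bits v)[i]?) : T = encode v := by
  funext z
  cases z with
  | ofNat i => exact h₂ i
  | negSucc i => exact h₁ _ (Int.negSucc_lt_zero i)

theorem encode_of_neg (v : ℕ) {z : ℤ} (hz : z < 0) : encode v z = none := by
  cases z with
  | ofNat i => exact absurd hz (by simp)
  | negSucc i => rfl

theorem encode_natCast (v i : ℕ) : encode v (i : ℤ) = (Nat.bits v)[i]? := rfl

theorem Exec.inc_tape {μ : Mem} (hμ : μ.InWindow B) (j v : ℕ) (hv : (v + 1).size ≤ B) :
    Exec n B (.inc j) (μ.tape j (encode v) 0) (μ.tape j (encode (v + 1)) 0) := by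
  rw [← Nat.size_eq_bits_len, bits_succ] at hv
  obtain ⟨T', h', hex, hlt, heq, -, hlt'⟩ := Exec.inc_forward (n := n) hμ j (Nat.bits v)
    (encode v) 0 (fun i => by simp [encode_natCast]) (by simpa using hv)
  have hT' : T' = encode (v + 1) := eq_encode
    (fun z hz => by rw [hlt z (by simpa using hz), encode_of_neg v hz])
    (fun i => by rw [bits_succ]; simpa using heq i)
  refine Exec.seq (by simpa using hex) ?_
  rw [hT']
  refine Exec.home hμ j _ h' (by omega) (fun i hi => ?_) rfl
  rw [encode_natCast, bits_succ, List.getElem?_eq_getElem (by omega)]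
  rfl

theorem Exec.dec_tape {μ : Mem} (hμ : μ.InWindow B) (j v : ℕ) (hv : (v + 1).size ≤ B) :
    Exec n B (.dec j) (μ.tape j (encode (v + 1)) 0) (μ.tape j (encode v) 0) := by
  have hmem : true ∈ Nat.bits (v + 1) := by
    rw [bits_succ]
    generalize Nat.bits v = l
    induction l with
    | nil => simp [succDigits]
    | cons d l ih => cases d <;> simp [succDigits, ih]
  rw [← Nat.size_eq_bits_len] at hv
  obtain ⟨T', h', hex, hlt, heq, -, hlt'⟩ := Exec.dec_forward (n := n) hμ j (Nat.bits (v + 1))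
    (encode (v + 1)) 0 (fun i => by simp [encode_natCast]) (by simpa using hv) hmem
  rw [bits_pred] at hlt'
  have hT' : T' = encode v := eq_encode
    (fun z hz => by rw [hlt z (by simpa using hz), encode_of_neg _ hz])
    (fun i => by rw [← bits_pred]; simpa using heq i)
  have hle : (Nat.bits v).length ≤ B := by
    rw [Nat.size_eq_bits_len] at hv ⊢
    exact (Nat.size_le_size (Nat.le_succ v)).trans hv
  refine Exec.seq (by simpa using hex) ?_
  rw [hT']
  refine Exec.home hμ j _ h' (by omega) (fun i hi => ?_) rfl
  rw [encode_natCast, List.getElem?_eq_getElem (by omega)]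
  rfl

end StructuredTM

/-! ### Register programs -/

namespace StructuredTM

variable {n B : ℕ}

/-- The memory in which tape `j` holds the number `R j`, with all heads on cell `0`. -/
def regMem (pos : ℕ) (R : ℕ → ℕ) (o : List DyadicSymbol) : Mem :=
  ⟨pos, fun j => encode (R j), fun _ => 0, o⟩

theorem regMem_inWindow (pos : ℕ) (R : ℕ → ℕ) (o : List DyadicSymbol) :
    (regMem pos R o).InWindow B := fun j => by simp [regMem]

theorem regMem_update (pos : ℕ) (R : ℕ → ℕ) (o : List DyadicSymbol) (j v : ℕ) :
    regMem pos (Function.update R j v) o = (regMem pos R o).tape j (encode v) 0 := by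
  ext : 1 <;> try rfl
  · funext i
    by_cases hi : i = j
    · subst hi; simp [regMem, Mem.tape]
    · simp [regMem, Mem.tape, hi]
  · simp [regMem, Mem.tape]

/-- Execution of a program between memories holding numbers; the input head does not move. -/
def RegExec (n B pos : ℕ) (p : Cmd) (R : ℕ → ℕ) (o : List DyadicSymbol) (R' : ℕ → ℕ)
    (o' : List DyadicSymbol) : Prop :=
  Exec n B p (regMem pos R o) (regMem pos R' o')

variable {pos : ℕ} {R R' R'' : ℕ → ℕ} {o o' o'' : List DyadicSymbol}

theorem RegExec.skip : RegExec n B pos .skip R o R o := Exec.skip _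

theorem RegExec.seq {p q : Cmd} (h : RegExec n B pos p R o R' o')
    (h' : RegExec n B pos q R' o' R'' o'') : RegExec n B pos (.seq p q) R o R'' o'' :=
  Exec.seq h h'

theorem RegExec.emit (d : DyadicSymbol) :
    RegExec n B pos (.act (.emit d)) R o R (o ++ [d]) :=
  Exec.act (.emit d) (regMem pos R o) (regMem_inWindow pos R _)

theorem RegExec.inc (j : ℕ) (h : R j + 1 < 2 ^ B) (hR : R' = Function.update R j (R j + 1)) :
    RegExec n B pos (.inc j) R o R' o := by
  have := Exec.inc_tape (n := n) (regMem_inWindow (B := B) pos R o) j (R j) (Nat.size_le.2 h)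
  rwa [← regMem_update, ← regMem_update, Function.update_eq_self, ← hR] at this

theorem RegExec.dec (j : ℕ) {v : ℕ} (hv : R j = v + 1) (h : R j < 2 ^ B) :
    RegExec n B pos (.dec j) R o (Function.update R j v) o := by
  rw [hv] at h
  have := Exec.dec_tape (n := n) (regMem_inWindow (B := B) pos R o) j v (Nat.size_le.2 h)
  rwa [← regMem_update, ← regMem_update, ← hv, Function.update_eq_self] at this

/-- The test whether register `j` is nonzero. -/
def Test.nonzero (j : ℕ) : Test := .tape j Option.isSome

theorem eval_nonzero (j : ℕ) : (Test.nonzero j).eval n (regMem pos R o) = decide (R j ≠ 0) := by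
  have : (Test.nonzero j).eval n (regMem pos R o) = ((Nat.bits (R j))[0]?).isSome := rfl
  rw [this]
  rcases Nat.eq_zero_or_pos (R j) with h | h
  · simp [h]
  · obtain ⟨w, hw⟩ := Nat.exists_eq_succ_of_ne_zero h.ne'
    rw [hw, Nat.succ_eq_add_one, bits_succ]
    cases Nat.bits w with
    | nil => simp [succDigits]
    | cons d l => cases d <;> simp [succDigits]

/-- Repeat the body while register `j` is nonzero, decrementing it before each round. -/
def Cmd.countdown (j : ℕ) (p : Cmd) : Cmd := .loop (.nonzero j) (.seq (.dec j) p)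

/-- A countdown loop with an explicit family of intermediate states: `S k` are the registers and
`O k` is the output when `k` rounds are left. -/
theorem RegExec.countdown {p : Cmd} (j : ℕ) (S : ℕ → ℕ → ℕ) (O : ℕ → List DyadicSymbol) (m : ℕ)
    (hm : m < 2 ^ B) (hS : ∀ k, k ≤ m → S k j = k)
    (hp : ∀ k, k < m →
      RegExec n B pos p (Function.update (S (k + 1)) j k) (O (k + 1)) (S k) (O k)) :
    RegExec n B pos (.countdown j p) (S m) (O m) (S 0) (O 0) := by
  induction m with
  | zero => exact Exec.loopDone (by rw [eval_nonzero]; simp [hS])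
  | succ m ih =>
    have hSm := hS (m + 1) le_rfl
    refine Exec.loopStep (by rw [eval_nonzero]; simp [hSm]) (Exec.seq ?_ (hp m (by omega)))
      (ih (by omega) (fun k hk => hS k (by omega)) fun k hk => hp k (by omega))
    exact RegExec.dec j hSm (by omega)

/-- Set register `j` to zero. -/
def Cmd.clear (j : ℕ) : Cmd := .countdown j .skip

theorem RegExec.clear (j : ℕ) (h : R j < 2 ^ B) (hR : R' = Function.update R j 0) :
    RegExec n B pos (.clear j) R o R' o := by
  have := RegExec.countdown (n := n) (B := B) (pos := pos) (p := .skip) j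
    (fun k => Function.update R j k) (fun _ => o) (R j) h (fun k _ => by simp)
    (fun k _ => by simpa using RegExec.skip)
  rwa [Function.update_eq_self, ← hR] at this

/-- Move the content of register `i` to the empty register `j`. -/
def Cmd.transfer (i j : ℕ) : Cmd := .countdown i (.inc j)

theorem RegExec.transfer {i j : ℕ} (hij : i ≠ j) (h : R i < 2 ^ B) (hj : R j = 0)
    (hR : R' = Function.update (Function.update R i 0) j (R i)) :
    RegExec n B pos (.transfer i j) R o R' o := by
  have := RegExec.countdown (n := n) (B := B) (pos := pos) (p := .inc j) i
    (fun k r => if r = i then k else if r = j then R i - k else R r) (fun _ => o) (R i) h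
    (fun k _ => by simp) (fun k hk => by
      refine RegExec.inc j ?_ ?_
      · grind
      · funext r; simp only [Function.update_apply]; grind)
  rw [Cmd.transfer]
  convert this using 1
  · funext r; grind
  · rw [hR]; funext r; simp only [Function.update_apply]; grind

/-- Copy the content of register `i` to the empty register `j`, using the empty register `t`. -/
def Cmd.copy (i j t : ℕ) : Cmd :=
  .seq (.countdown i (.seq (.inc j) (.inc t))) (.transfer t i)

theorem RegExec.copy {i j t : ℕ} (hij : i ≠ j) (hit : i ≠ t) (hjt : j ≠ t) (h : R i < 2 ^ B)
    (hj : R j = 0) (ht : R t = 0) (hR : R' = Function.update R j (R i)) :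
    RegExec n B pos (.copy i j t) R o R' o := by
  have h₁ := RegExec.countdown (n := n) (B := B) (pos := pos) (p := .seq (.inc j) (.inc t)) i
    (fun k r => if r = i then k else if r = j then R i - k else if r = t then R i - k else R r)
    (fun _ => o) (R i) h (fun k _ => by simp) (fun k hk => by
      refine RegExec.seq (RegExec.inc j ?_ rfl) (RegExec.inc t ?_ ?_)
      · grind
      · simp only [Function.update_apply]; grind
      · funext r; simp only [Function.update_apply]; grind)
  refine RegExec.seq (R' := fun r => if r = i then 0 else if r = j then R i else
    if r = t then R i else R r) ?_ (RegExec.transfer hit.symm ?_ ?_ ?_)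
  · convert h₁ using 1
    · funext r; grind
    · simp
  · grind
  · grind
  · rw [hR]; funext r; simp only [Function.update_apply]; grind

end StructuredTM

/-! ### Functions computed with polynomially bounded registers -/

namespace StructuredTM

/-- The environment obtained from `ρ` by binding a new variable with value `x`; the new variable has
index `0`. -/
def bind (x : ℕ) (ρ : ℕ → ℕ) : ℕ → ℕ
  | 0 => x
  | i + 1 => ρ i

/-- A function of an environment `ρ : ℕ → ℕ`, which assigns values to variables, is bounded by a
polynomial in `sup ρ`. -/
def PolyBdd (f : (ℕ → ℕ) → ℕ) : Prop :=
  ∃ c : ℕ, ∀ (ρ : ℕ → ℕ) (N : ℕ), (∀ i, ρ i ≤ N) → f ρ ≤ (N + 2) ^ c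

/-- A function of an environment is computed by a program all of whose registers stay bounded by a
polynomial in the values of the variables. Variable `i` is kept in register `v i`; registers from
`s` on serve as scratch space, are initially zero and are reset to zero; the result is put into the
register `out`; no other register changes. Distinct variables may share a register. -/
structure PolyReg (f : (ℕ → ℕ) → ℕ) : Prop where
  bdd : PolyBdd f
  prog : ∀ (v : ℕ → ℕ) (s out : ℕ), (∀ i, v i < s) → out < s → (∀ i, v i ≠ out) →
    ∃ (p : Cmd) (c : ℕ), ∀ (n B pos N : ℕ) (R : ℕ → ℕ) (o : List DyadicSymbol),
      (∀ r, s ≤ r → R r = 0) → R out = 0 → (∀ i, R (v i) ≤ N) → (N + 2) ^ c ≤ 2 ^ B →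
      RegExec n B pos p R o (Function.update R out (f fun i => R (v i))) o

theorem pow_le_pow_exp (N : ℕ) {c d : ℕ} (h : c ≤ d) : (N + 2) ^ c ≤ (N + 2) ^ d :=
  Nat.pow_le_pow_right (by omega) h

theorem pow_add_pow_lt (N : ℕ) {c d e : ℕ} (hc : c + 2 ≤ e) (hd : d + 2 ≤ e) :
    (N + 2) ^ c + (N + 2) ^ d < (N + 2) ^ e := by
  have h₁ := pow_le_pow_exp N (le_max_left c d)
  have h₂ := pow_le_pow_exp N (le_max_right c d)
  have h₃ := pow_le_pow_exp N (show max c d + 2 ≤ e by omega)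
  have h₄ : (N + 2) ^ (max c d + 2) = (N + 2) ^ max c d * ((N + 2) * (N + 2)) := by ring
  have h₅ : 0 < (N + 2) ^ max c d := by positivity
  nlinarith [Nat.zero_le (N * N), Nat.zero_le N]

theorem PolyBdd.add {f g : (ℕ → ℕ) → ℕ} (hf : PolyBdd f) (hg : PolyBdd g) :
    PolyBdd fun ρ => f ρ + g ρ := by
  obtain ⟨c, hc⟩ := hf
  obtain ⟨d, hd⟩ := hg
  exact ⟨c + d + 2, fun ρ N hN => (add_le_add (hc ρ N hN) (hd ρ N hN)).trans
    (pow_add_pow_lt N (by omega) (by omega)).le⟩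

theorem PolyBdd.mul {f g : (ℕ → ℕ) → ℕ} (hf : PolyBdd f) (hg : PolyBdd g) :
    PolyBdd fun ρ => f ρ * g ρ := by
  obtain ⟨c, hc⟩ := hf
  obtain ⟨d, hd⟩ := hg
  exact ⟨c + d, fun ρ N hN => by rw [pow_add]; exact Nat.mul_le_mul (hc ρ N hN) (hd ρ N hN)⟩

theorem PolyBdd.const (k : ℕ) : PolyBdd fun _ => k :=
  ⟨k, fun _ N _ => Nat.lt_pow_self (by omega) |>.le⟩

theorem PolyReg.var (i : ℕ) : PolyReg fun ρ => ρ i where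
  bdd := ⟨1, fun ρ N hN => by have := hN i; simp; omega⟩
  prog v s out hv hout hne := by
    refine ⟨.copy (v i) out s, 1, fun n B pos N R o hR hR₀ hN hB => ?_⟩
    have h1 := hN i
    exact RegExec.copy (hne i) (hv i).ne hout.ne (by rw [pow_one] at hB; omega) hR₀
      (hR s le_rfl) rfl

theorem PolyReg.zero : PolyReg fun _ => 0 where
  bdd := PolyBdd.const 0
  prog v s out hv hout hne := by
    refine ⟨.skip, 0, fun n B pos N R o hR hR₀ hN hB => ?_⟩
    rw [← hR₀, Function.update_eq_self]
    exact RegExec.skip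

theorem PolyReg.succ {f : (ℕ → ℕ) → ℕ} (hf : PolyReg f) : PolyReg fun ρ => f ρ + 1 where
  bdd := hf.bdd.add (PolyBdd.const 1)
  prog v s out hv hout hne := by
    obtain ⟨c, hc⟩ := hf.bdd
    obtain ⟨p, d, hp⟩ := hf.prog v s out hv hout hne
    refine ⟨.seq p (.inc out), c + d + 2, fun n B pos N R o hR hR₀ hN hB => ?_⟩
    refine (hp n B pos N R o hR hR₀ hN ((pow_le_pow_exp N (by omega)).trans hB)).seq
      (RegExec.inc out ?_ (by simp))
    have h₁ := hc (fun i => R (v i)) N hN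
    have h₂ := pow_add_pow_lt N (c := c) (d := 0) (e := c + d + 2) (by omega) (by omega)
    simp only [Function.update_self]
    rw [pow_zero] at h₂
    omega

theorem PolyReg.const (k : ℕ) : PolyReg fun _ => k := by
  induction k with
  | zero => exact PolyReg.zero
  | succ k ih => exact ih.succ

/-- Renaming of variables. -/
theorem PolyReg.rename {f : (ℕ → ℕ) → ℕ} (hf : PolyReg f) (σ : ℕ → ℕ) :
    PolyReg fun ρ => f fun i => ρ (σ i) where
  bdd := by
    obtain ⟨c, hc⟩ := hf.bdd
    exact ⟨c, fun ρ N hN => hc _ N fun i => hN _⟩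
  prog v s out hv hout hne := by
    obtain ⟨p, c, hp⟩ := hf.prog (fun i => v (σ i)) s out (fun i => hv _) hout fun i => hne _
    exact ⟨p, c, fun n B pos N R o hR hR₀ hN hB => hp n B pos N R o hR hR₀ (fun i => hN _) hB⟩

theorem update_clear {R : ℕ → ℕ} {s out : ℕ} (x y : ℕ) (hs : R s = 0) (hne : out ≠ s) :
    Function.update R out y =
      Function.update (Function.update (Function.update R s x) out y) s 0 := by
  rw [Function.update_comm hne, Function.update_idem, ← hs, Function.update_eq_self]

/-- Local definition of a variable. The program for `F` is run with the value of `g` in the first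
scratch register `s`, and with scratch space from `s + 1` on. -/
theorem PolyReg.letIn {g : (ℕ → ℕ) → ℕ} {F : ℕ → (ℕ → ℕ) → ℕ} (hg : PolyReg g)
    (hF : PolyReg fun ρ => F (ρ 0) fun i => ρ (i + 1)) : PolyReg fun ρ => F (g ρ) ρ := by
  obtain ⟨a, ha⟩ := hg.bdd
  obtain ⟨b, hb⟩ := hF.bdd
  have hbind : ∀ (ρ : ℕ → ℕ) N, (∀ i, ρ i ≤ N) → ∀ i, bind (g ρ) ρ i ≤ (N + 2) ^ (a + 1) := by
    intro ρ N hN i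
    cases i with
    | zero => exact (ha ρ N hN).trans (pow_le_pow_exp N (by omega))
    | succ i =>
      have h₁ := hN i
      have h₂ := pow_le_pow_exp N (show 1 ≤ a + 1 by omega)
      rw [pow_one] at h₂
      exact le_trans h₁ (by omega)
  have hpow : ∀ N e, ((N + 2) ^ (a + 1) + 2) ^ e ≤ (N + 2) ^ ((a + 3) * e) := fun N e => by
    rw [pow_mul]
    refine Nat.pow_le_pow_left ?_ e
    have := (pow_add_pow_lt N (c := a + 1) (d := 1) (e := a + 3) (by omega) (by omega)).le
    rw [pow_one] at this
    omega
  refine ⟨⟨(a + 3) * b, fun ρ N hN => ?_⟩, fun v s out hv hout hne => ?_⟩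
  · exact (hb (bind (g ρ) ρ) _ (hbind ρ N hN)).trans (hpow N b)
  · obtain ⟨p, c, hp⟩ := hg.prog v (s + 1) s (fun i => by have := hv i; omega) (by omega)
      (fun i => (hv i).ne)
    obtain ⟨q, d, hq⟩ := hF.prog (bind s v) (s + 1) out
      (fun i => by
        cases i with
        | zero => exact Nat.lt_succ_self s
        | succ i => exact (hv i).trans (Nat.lt_succ_self s))
      (by omega) (fun i => by
        cases i with
        | zero => exact hout.ne'
        | succ i => exact hne i)
    refine ⟨.seq p (.seq q (.clear s)), c + (a + 3) * d + (a + 2),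
      fun n B pos N R o hR hR₀ hN hB => ?_⟩
    set x := g fun i => R (v i) with hx
    have hvs : ∀ i, Function.update R s x (v i) = R (v i) := fun i =>
      Function.update_of_ne (hv i).ne _ _
    have hval : (fun i => Function.update R s x (bind s v i)) = bind x fun i => R (v i) := by
      funext i
      cases i with
      | zero => simp [bind]
      | succ i => exact hvs i
    have h₁ := hp n B pos N R o (fun r hr => hR r (by omega)) (hR s le_rfl) hN
      ((pow_le_pow_exp N (by omega)).trans hB)
    have h₂ := hq n B pos ((N + 2) ^ (a + 1)) (Function.update R s x) o
      (fun r hr => by rw [Function.update_of_ne (by omega)]; exact hR r (by omega))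
      (by rw [Function.update_of_ne hout.ne]; exact hR₀)
      (fun i => by rw [congrFun hval i]; exact hbind _ N hN i)
      ((hpow N d).trans ((pow_le_pow_exp N (by omega)).trans hB))
    have hres : F (Function.update R s x (bind s v 0))
        (fun i => Function.update R s x (bind s v (i + 1))) = F x fun i => R (v i) := by
      rw [congrFun hval 0]
      congr 1
      exact funext fun i => congrFun hval (i + 1)
    rw [hres] at h₂
    refine h₁.seq (h₂.seq (RegExec.clear s ?_ (update_clear x _ (hR s le_rfl) hout.ne)))
    rw [Function.update_of_ne hout.ne', Function.update_self]
    have h₃ := ha (fun i => R (v i)) N hN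
    have h₄ := pow_le_pow_exp N (show (a + 2) ≤ c + (a + 3) * d + (a + 2) by omega)
    have h₅ := pow_add_pow_lt N (c := a) (d := 0) (e := a + 2) (by omega) (by omega)
    omega

/-- Bounded recursion: primitive recursion is admissible as long as all intermediate values are
polynomially bounded. Register `s` holds the number of remaining rounds, `s + 1` the index of the
round, `out` the intermediate value and `s + 2` the next one. -/
theorem PolyReg.natRec {cnt base G : (ℕ → ℕ) → ℕ} {step : ℕ → ℕ → (ℕ → ℕ) → ℕ}
    (hcnt : PolyReg cnt) (hbase : PolyReg base)
    (hstep : PolyReg fun ρ => step (ρ 0) (ρ 1) fun i => ρ (i + 2))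
    (hG : PolyBdd G)
    (hle : ∀ ρ, ∀ i ≤ cnt ρ,
      Nat.rec (motive := fun _ => ℕ) (base ρ) (fun i r => step i r ρ) i ≤ G ρ) :
    PolyReg fun ρ => Nat.rec (motive := fun _ => ℕ) (base ρ) (fun i r => step i r ρ) (cnt ρ) := by
  obtain ⟨a, ha⟩ := hcnt.bdd
  obtain ⟨b, hb⟩ := hG
  refine ⟨⟨b, fun ρ N hN => (hle ρ _ le_rfl).trans (hb ρ N hN)⟩, fun v s out hv hout hne => ?_⟩
  obtain ⟨p, c, hp⟩ := hcnt.prog v (s + 3) s (fun i => by have := hv i; omega) (by omega)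
    (fun i => (hv i).ne)
  obtain ⟨q, d, hq⟩ := hbase.prog v (s + 3) out (fun i => by have := hv i; omega) (by omega) hne
  obtain ⟨t, e, ht⟩ := hstep.prog (bind (s + 1) (bind out v)) (s + 3) (s + 2)
    (fun i => by
      match i with
      | 0 => simp [bind]
      | 1 => simp [bind]; omega
      | i + 2 => have := hv i; simp [bind]; omega)
    (by omega)
    (fun i => by
      match i with
      | 0 => simp [bind]
      | 1 => simp [bind]; omega
      | i + 2 => have := hv i; simp [bind]; omega)
  refine ⟨.seq p (.seq q (.seq (.countdown s (.seq t (.seq (.clear out)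
    (.seq (.transfer (s + 2) out) (.inc (s + 1)))))) (.clear (s + 1)))),
    c + d + (a + b + 4) * e + (a + b + 4), fun n B pos N R o hR hR₀ hN hB => ?_⟩
  set ρ : ℕ → ℕ := fun i => R (v i) with hρ
  set m := cnt ρ with hm
  set f : ℕ → ℕ := fun i => Nat.rec (motive := fun _ => ℕ) (base ρ) (fun i r => step i r ρ) i
    with hf
  have hma : m ≤ (N + 2) ^ a := ha ρ N hN
  have hfb : ∀ i ≤ m, f i ≤ (N + 2) ^ b := fun i hi => (hle ρ i hi).trans (hb ρ N hN)
  have hbig : (N + 2) ^ a + (N + 2) ^ b < (N + 2) ^ (a + b + 2) :=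
    pow_add_pow_lt N (by omega) (by omega)
  have hbig' : (N + 2) ^ (a + b + 2) + (N + 2) ^ 1 < (N + 2) ^ (a + b + 4) :=
    pow_add_pow_lt N (by omega) (by omega)
  have hN2 := pow_le_pow_exp N (show 1 ≤ a + b + 2 by omega)
  rw [pow_one] at hbig' hN2
  have hlt : (N + 2) ^ (a + b + 4) ≤ 2 ^ B := (pow_le_pow_exp N (by omega)).trans hB
  -- the registers when `k` rounds are left
  set S : ℕ → ℕ → ℕ := fun k r => if r = s then k else if r = s + 1 then m - k else
    if r = out then f (m - k) else R r with hS
  have hs0 := hR s le_rfl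
  have hs1 := hR (s + 1) (by omega)
  have hs2 := hR (s + 2) (by omega)
  have hvs : ∀ i, v i ≠ s ∧ v i ≠ s + 1 ∧ v i ≠ s + 2 ∧ v i ≠ out := fun i =>
    ⟨(hv i).ne, by have := hv i; omega, by have := hv i; omega, hne i⟩
  have h₁ := hp n B pos N R o (fun r hr => hR r (by omega)) hs0 hN
    ((pow_le_pow_exp N (by omega)).trans hB)
  have h₂ := hq n B pos N (Function.update R s m) o
    (fun r hr => by rw [Function.update_of_ne (by omega)]; exact hR r (by omega))
    (by rw [Function.update_of_ne hout.ne]; exact hR₀)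
    (fun i => by rw [Function.update_of_ne (hvs i).1]; exact hN i)
    ((pow_le_pow_exp N (by omega)).trans hB)
  have hSm : Function.update (Function.update R s m) out
      (base fun i => Function.update R s m (v i)) = S m := by
    have : (fun i => Function.update R s m (v i)) = ρ :=
      funext fun i => Function.update_of_ne (hvs i).1 _ _
    rw [this]
    have hf0 : f 0 = base ρ := rfl
    funext r
    simp only [Function.update_apply, hS, Nat.sub_self]
    grind
  rw [hSm] at h₂
  have h₃ := RegExec.countdown (n := n) (B := B) (pos := pos)
    (p := .seq t (.seq (.clear out) (.seq (.transfer (s + 2) out) (.inc (s + 1))))) s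
    S (fun _ => o) m (by omega) (fun k _ => by simp [hS]) (fun k hk => by
      set S' := Function.update (S (k + 1)) s k with hS'
      have hval : (fun i => S' (bind (s + 1) (bind out v) i)) =
          bind (m - (k + 1)) (bind (f (m - (k + 1))) ρ) := by
        funext i
        match i with
        | 0 => simp [bind, hS', hS]
        | 1 =>
          have : out ≠ s + 1 := by omega
          simp [bind, hS', hS, hout.ne, this]
        | i + 2 =>
          obtain ⟨e1, e2, e3, e4⟩ := hvs i
          simp [bind, hS', hS, e1, e2, e4, hρ]
      have hb1 := hfb (m - (k + 1)) (by omega)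
      have hb2 := hfb (m - k) (by omega)
      have hfs : f (m - k) = step (m - (k + 1)) (f (m - (k + 1))) ρ := by
        rw [show m - k = (m - (k + 1)) + 1 by omega]
      have g₁ := ht n B pos ((N + 2) ^ (a + b + 2)) S' o
        (fun r hr => by
          have := hR r (by omega)
          simp only [hS', hS, Function.update_apply]
          grind)
        (by simp only [hS', hS, Function.update_apply]; grind)
        (fun i => by
          rw [congrFun hval i]
          match i with
          | 0 => simp only [bind]; omega
          | 1 => simp only [bind]; omega
          | i + 2 => have := hN i; simp only [bind, hρ]; omega)
        ((Nat.pow_le_pow_left (by omega) e).trans ((pow_mul (N + 2) (a + b + 4) e).ge.trans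
          ((pow_le_pow_exp N (by omega)).trans hB)))
      have hres : step (S' (bind (s + 1) (bind out v) 0)) (S' (bind (s + 1) (bind out v) 1))
          (fun i => S' (bind (s + 1) (bind out v) (i + 2))) = f (m - k) := by
        rw [hfs, congrFun hval 0, congrFun hval 1]
        congr 1
        funext i
        exact congrFun hval (i + 2)
      rw [hres] at g₁
      refine g₁.seq (RegExec.seq (RegExec.clear out ?_ rfl) (RegExec.seq
        (RegExec.transfer (by omega) ?_ ?_ rfl) (RegExec.inc (s + 1) ?_ ?_)))
      · simp only [hS', hS, Function.update_apply]
        grind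
      · simp only [hS', hS, Function.update_apply]
        grind
      · simp only [hS', hS, Function.update_apply]
        grind
      · simp only [hS', hS, Function.update_apply]
        grind
      · funext r
        simp only [hS', hS, Function.update_apply]
        grind)
  refine h₁.seq (h₂.seq (h₃.seq (RegExec.clear (s + 1) ?_ ?_)))
  · simp only [hS]
    grind
  · funext r
    simp only [hS, Function.update_apply]
    grind

end StructuredTM

/-! ### Arithmetic with polynomially bounded registers -/

namespace StructuredTM

open Finset

namespace PolyReg

variable {f g h : (ℕ → ℕ) → ℕ}

theorem congr (hf : PolyReg f) (h : ∀ ρ, f ρ = g ρ) : PolyReg g :=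
  (funext h : f = g) ▸ hf

theorem shift (hf : PolyReg f) : PolyReg fun ρ => f fun i => ρ (i + 1) := hf.rename _

theorem shift₂ (hf : PolyReg f) : PolyReg fun ρ => f fun i => ρ (i + 2) := hf.rename _

theorem comp₁ {op : ℕ → ℕ} (hop : PolyReg fun ρ => op (ρ 0)) (hf : PolyReg f) :
    PolyReg fun ρ => op (f ρ) :=
  letIn (F := fun x _ => op x) hf hop

theorem comp₂ {op : ℕ → ℕ → ℕ} (hop : PolyReg fun ρ => op (ρ 0) (ρ 1)) (hf : PolyReg f)
    (hg : PolyReg g) : PolyReg fun ρ => op (f ρ) (g ρ) :=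
  letIn (F := fun x ρ => op x (g ρ)) hf
    (letIn (F := fun y ρ => op (ρ 0) y) hg.shift (hop.rename fun i => 1 - i))

theorem add (hf : PolyReg f) (hg : PolyReg g) : PolyReg fun ρ => f ρ + g ρ := by
  have key : ∀ x i : ℕ, Nat.rec (motive := fun _ => ℕ) x (fun _ r => r + 1) i = x + i := by
    intro x i
    induction i with
    | zero => rfl
    | succ i ih => simp only [ih]; omega
  refine (natRec (G := fun ρ => f ρ + g ρ) (step := fun _ r _ => r + 1) hg hf (var 1).succ
    (hf.bdd.add hg.bdd) fun ρ i hi => ?_).congr fun ρ => key _ _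
  rw [key]
  omega

theorem pred (hf : PolyReg f) : PolyReg fun ρ => f ρ - 1 := by
  have key : ∀ i : ℕ, Nat.rec (motive := fun _ => ℕ) 0 (fun i _ => i) i = i - 1 := by
    intro i
    cases i <;> rfl
  refine (natRec (G := f) (step := fun i _ _ => i) hf zero (var 0) hf.bdd
    fun ρ i hi => ?_).congr fun ρ => key _
  rw [key]
  omega

theorem sub (hf : PolyReg f) (hg : PolyReg g) : PolyReg fun ρ => f ρ - g ρ := by
  have key : ∀ x i : ℕ, Nat.rec (motive := fun _ => ℕ) x (fun _ r => r - 1) i = x - i := by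
    intro x i
    induction i with
    | zero => rfl
    | succ i ih => simp only [ih]; omega
  refine (natRec (G := f) (step := fun _ r _ => r - 1) hg hf (var 1).pred hf.bdd
    fun ρ i hi => ?_).congr fun ρ => key _ _
  rw [key]
  omega

theorem mul (hf : PolyReg f) (hg : PolyReg g) : PolyReg fun ρ => f ρ * g ρ := by
  have key : ∀ x i : ℕ, Nat.rec (motive := fun _ => ℕ) 0 (fun _ r => r + x) i = x * i := by
    intro x i
    induction i with
    | zero => rfl
    | succ i ih => simp only [ih]; ring
  refine (natRec (G := fun ρ => f ρ * g ρ) (step := fun _ r ρ => r + f ρ) hg zero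
    ((var 1).add hf.shift₂) (hf.bdd.mul hg.bdd) fun ρ i hi => ?_).congr fun ρ => key _ _
  rw [key]
  exact Nat.mul_le_mul_left _ hi

theorem ifZero (hf : PolyReg f) (hg : PolyReg g) (hh : PolyReg h) :
    PolyReg fun ρ => if f ρ = 0 then g ρ else h ρ := by
  have key : ∀ x y i : ℕ, Nat.rec (motive := fun _ => ℕ) x (fun _ _ => y) i =
      if i = 0 then x else y := by
    intro x y i
    cases i <;> rfl
  refine (natRec (G := fun ρ => g ρ + h ρ) (step := fun _ _ ρ => h ρ) hf hg hh.shift₂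
    (hg.bdd.add hh.bdd) fun ρ i hi => ?_).congr fun ρ => key _ _ _
  rw [key]
  split_ifs <;> omega

end PolyReg

/-- A predicate on environments whose indicator function is computed with polynomially bounded
registers. -/
def PolyPred (P : (ℕ → ℕ) → Prop) : Prop :=
  open Classical in PolyReg fun ρ => if P ρ then 1 else 0

namespace PolyReg

variable {f g h : (ℕ → ℕ) → ℕ} {P : (ℕ → ℕ) → Prop}

theorem ite [∀ ρ, Decidable (P ρ)] (hP : PolyPred P) (hf : PolyReg f) (hg : PolyReg g) :
    PolyReg fun ρ => if P ρ then f ρ else g ρ :=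
  (ifZero hP hg hf).congr fun ρ => by by_cases h : P ρ <;> simp [h]

end PolyReg

namespace PolyPred

variable {f g : (ℕ → ℕ) → ℕ} {P Q : (ℕ → ℕ) → Prop}

theorem congr (hP : PolyPred P) (h : ∀ ρ, P ρ ↔ Q ρ) : PolyPred Q :=
  (funext fun ρ => propext (h ρ) : P = Q) ▸ hP

theorem comp₁ {P : ℕ → Prop} (hP : PolyPred fun ρ => P (ρ 0)) (hf : PolyReg f) :
    PolyPred fun ρ => P (f ρ) := by
  classical
  exact PolyReg.comp₁ (op := fun x => if P x then 1 else 0) hP hf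

theorem le (hf : PolyReg f) (hg : PolyReg g) : PolyPred fun ρ => f ρ ≤ g ρ :=
  ((hf.sub hg).ifZero (.const 1) .zero).congr fun ρ => by simp [Nat.sub_eq_zero_iff_le]

theorem lt (hf : PolyReg f) (hg : PolyReg g) : PolyPred fun ρ => f ρ < g ρ := le hf.succ hg

theorem and (hP : PolyPred P) (hQ : PolyPred Q) : PolyPred fun ρ => P ρ ∧ Q ρ := by
  classical
  exact (PolyReg.ite hP hQ .zero).congr fun ρ => by by_cases h : P ρ <;> simp [h]

theorem not (hP : PolyPred P) : PolyPred fun ρ => ¬P ρ := by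
  classical
  exact (PolyReg.ite hP .zero (.const 1)).congr fun ρ => by by_cases h : P ρ <;> simp [h]

theorem eq (hf : PolyReg f) (hg : PolyReg g) : PolyPred fun ρ => f ρ = g ρ :=
  ((le hf hg).and (le hg hf)).congr fun _ => le_antisymm_iff.symm

end PolyPred

namespace PolyReg

variable {f g h : (ℕ → ℕ) → ℕ} {P : (ℕ → ℕ) → Prop}

theorem mod (hf : PolyReg f) (hg : PolyReg g) : PolyReg fun ρ => f ρ % g ρ := by
  have key : ∀ y i : ℕ, Nat.rec (motive := fun _ => ℕ) 0
      (fun _ r => if r + 1 = y then 0 else r + 1) i = i % y := by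
    intro y i
    induction i with
    | zero => simp
    | succ i ih =>
      simp only [ih]
      rw [Nat.add_mod_eq_ite]
      rcases Nat.eq_zero_or_pos y with rfl | hy
      · simp
      · have := Nat.mod_lt i hy
        rcases Nat.lt_or_ge 1 y with h1 | h1
        · rw [Nat.mod_eq_of_lt h1]
          split_ifs <;> omega
        · have : y = 1 := by omega
          subst this
          simp [Nat.mod_one]
  refine (natRec (G := f) (step := fun _ r ρ => if r + 1 = g ρ then 0 else r + 1) hf zero
    (ite (PolyPred.eq (var 1).succ hg.shift₂) zero (var 1).succ) hf.bdd
    fun ρ i hi => ?_).congr fun ρ => key _ _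
  rw [key]
  exact (Nat.mod_le _ _).trans hi

theorem div (hf : PolyReg f) (hg : PolyReg g) : PolyReg fun ρ => f ρ / g ρ := by
  have key : ∀ y i : ℕ, Nat.rec (motive := fun _ => ℕ) 0
      (fun i r => r + if (i + 1) % y = 0 then 1 else 0) i = i / y := by
    intro y i
    induction i with
    | zero => simp
    | succ i ih =>
      simp only [ih]
      rw [Nat.succ_div]
      simp [Nat.dvd_iff_mod_eq_zero]
  refine (natRec (G := f) (step := fun i r ρ => r + if (i + 1) % g ρ = 0 then 1 else 0) hf zero
    ((var 1).add (ite (PolyPred.eq ((var 0).succ.mod hg.shift₂) zero) (const 1) zero)) hf.bdd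
    fun ρ i hi => ?_).congr fun ρ => key _ _
  rw [key]
  exact (Nat.div_le_self _ _).trans hi

theorem _root_.StructuredTM.PolyBdd.sum {n : (ℕ → ℕ) → ℕ} {F : ℕ → (ℕ → ℕ) → ℕ} (hn : PolyBdd n)
    (hF : PolyBdd fun ρ => F (ρ 0) fun i => ρ (i + 1)) :
    PolyBdd fun ρ => ∑ i ∈ range (n ρ), F i ρ := by
  obtain ⟨a, ha⟩ := hn
  obtain ⟨b, hb⟩ := hF
  refine ⟨a + (a + 4) * b, fun ρ N hN => ?_⟩
  have hle : ∀ i ∈ range (n ρ), F i ρ ≤ (N + 2) ^ ((a + 4) * b) := by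
    intro i hi
    have h₁ := hb (bind i ρ) ((N + 2) ^ (a + 1)) (fun j => by
      cases j with
      | zero =>
        exact ((mem_range.1 hi).le.trans (ha ρ N hN)).trans (pow_le_pow_exp N (by omega))
      | succ j =>
        have h₂ := pow_le_pow_exp N (show 1 ≤ a + 1 by omega)
        have h₃ := hN j
        rw [pow_one] at h₂
        exact h₃.trans (by omega))
    refine h₁.trans ?_
    rw [pow_mul]
    refine Nat.pow_le_pow_left ?_ b
    have := (pow_add_pow_lt N (c := a + 1) (d := 1) (e := a + 4) (by omega) (by omega)).le
    rw [pow_one] at this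
    omega
  refine (sum_le_card_nsmul _ _ _ hle).trans ?_
  rw [card_range, smul_eq_mul, pow_add]
  exact Nat.mul_le_mul_right _ (ha ρ N hN)

theorem sum {n : (ℕ → ℕ) → ℕ} {F : ℕ → (ℕ → ℕ) → ℕ} (hn : PolyReg n)
    (hF : PolyReg fun ρ => F (ρ 0) fun i => ρ (i + 1)) :
    PolyReg fun ρ => ∑ i ∈ range (n ρ), F i ρ := by
  have key : ∀ (u : ℕ → ℕ) (i : ℕ), Nat.rec (motive := fun _ => ℕ) 0 (fun i r => r + u i) i =
      ∑ j ∈ range i, u j := by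
    intro u i
    induction i with
    | zero => rfl
    | succ i ih => rw [sum_range_succ, ← ih]
  refine (natRec (G := fun ρ => ∑ i ∈ range (n ρ), F i ρ) (step := fun i r ρ => r + F i ρ) hn zero
    ((var 1).add (hF.rename fun i => if i = 0 then 0 else i + 1))
    (hn.bdd.sum hF.bdd) fun ρ i hi => ?_).congr fun ρ => key (fun i => F i ρ) _
  rw [key (fun i => F i ρ)]
  exact sum_le_sum_of_subset (range_subset_range.2 hi)

end PolyReg

/-- The product `∏ i < k, f i` modulo `m`. For `m = 0` it is set to zero, as `x % 0 = x` would not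
be polynomially bounded. -/
def prodMod (m k : ℕ) (f : ℕ → ℕ) : ℕ := if m = 0 then 0 else (∏ i ∈ range k, f i) % m

theorem prodMod_of_pos {m : ℕ} (hm : 0 < m) (k : ℕ) (f : ℕ → ℕ) :
    prodMod m k f = (∏ i ∈ range k, f i) % m := if_neg hm.ne'

theorem PolyReg.prodMod {m k : (ℕ → ℕ) → ℕ} {F : ℕ → (ℕ → ℕ) → ℕ} (hm : PolyReg m)
    (hk : PolyReg k) (hF : PolyReg fun ρ => F (ρ 0) fun i => ρ (i + 1)) :
    PolyReg fun ρ => prodMod (m ρ) (k ρ) fun i => F i ρ := by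
  have key : ∀ (m : ℕ) (u : ℕ → ℕ) (i : ℕ), Nat.rec (motive := fun _ => ℕ)
      (if m = 0 then 0 else 1 % m) (fun i r => if m = 0 then 0 else r * u i % m) i =
      StructuredTM.prodMod m i u := by
    intro m u i
    rcases Nat.eq_zero_or_pos m with rfl | hm
    · cases i <;> simp [StructuredTM.prodMod]
    · rw [prodMod_of_pos hm]
      induction i with
      | zero => simp [hm.ne']
      | succ i ih => rw [prod_range_succ, ← Nat.mod_mul_mod, ← ih]; simp [hm.ne']
  have hF' : PolyReg fun ρ => F (ρ 0) fun i => ρ (i + 2) :=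
    hF.rename fun i => if i = 0 then 0 else i + 1
  refine (natRec (G := m) (base := fun ρ => if m ρ = 0 then 0 else 1 % m ρ)
    (step := fun i r ρ => if m ρ = 0 then 0 else r * F i ρ % m ρ) hk
    (ifZero hm zero ((const 1).mod hm)) (ifZero hm.shift₂ zero (((var 1).mul hF').mod hm.shift₂))
    hm.bdd fun ρ i hi => ?_).congr fun ρ => key _ (fun i => F i ρ) _
  rw [key (m ρ) (fun i => F i ρ), StructuredTM.prodMod]
  split_ifs with h
  · exact Nat.zero_le _
  · exact (Nat.mod_lt _ (Nat.pos_of_ne_zero h)).le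

/-- Functions vanishing from some point on. -/
theorem PolyReg.table (T : ℕ → ℕ) (m : ℕ) : PolyReg fun ρ => if ρ 0 < m then T (ρ 0) else 0 := by
  induction m with
  | zero => exact PolyReg.zero.congr fun ρ => by simp
  | succ m ih =>
    refine (PolyReg.ite (PolyPred.eq (var 0) (const m)) (const (T m)) ih).congr fun ρ => ?_
    rcases lt_trichotomy (ρ 0) m with h | h | h
    · simp [h, h.ne, h.trans (Nat.lt_succ_self m)]
    · simp [h]
    · simp [h.ne', not_lt.2 h.le, not_lt.2 (Nat.succ_le_of_lt h)]

end StructuredTM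

/-! ### The digits of an automatic sequence -/

namespace StructuredTM

open Finset

/-- The function obtained by reading the base-`k` digits of `n`, most significant digit first,
with a transition function `δ` on numbers below `Q` starting in `q₀` is computable. The recursion
over `t` runs through the prefixes `n / k ^ (n - t)` of the expansion. -/
theorem PolyReg.digitAutomaton (k Q q₀ : ℕ) (hk : 2 ≤ k) (hq₀ : q₀ < Q) (δ : ℕ → ℕ → ℕ)
    (hδ : ∀ q < Q, ∀ d < k, δ q d < Q) (st : ℕ → ℕ) (hst₀ : st 0 = q₀)
    (hst : ∀ n, n ≠ 0 → st n = δ (st (n / k)) (n % k)) : PolyReg fun ρ => st (ρ 0) := by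
  have hstQ : ∀ n, st n < Q := by
    intro n
    induction n using Nat.strong_induction_on with
    | _ n ih =>
      rcases Nat.eq_zero_or_pos n with rfl | hn
      · rwa [hst₀]
      · rw [hst n hn.ne']
        exact hδ _ (ih _ (Nat.div_lt_self hn hk)) _ (Nat.mod_lt _ (by omega))
  -- division by a power of `k`
  have hdiv : PolyReg fun ρ => ρ 0 / k ^ ρ 1 := by
    have key : ∀ n t : ℕ, Nat.rec (motive := fun _ => ℕ) n (fun _ r => r / k) t = n / k ^ t := by
      intro n t
      induction t with
      | zero => simp
      | succ t ih => simp only [ih, pow_succ, Nat.div_div_eq_div_mul]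
    refine (natRec (G := fun ρ => ρ 0) (step := fun _ r _ => r / k) (var 1) (var 0)
      ((var 1).div (const k)) (var 0).bdd fun ρ i hi => ?_).congr fun ρ => key _ _
    rw [key]
    exact Nat.div_le_self _ _
  -- one transition; a pair of a state and a digit is coded as one number
  have htab := PolyReg.table (fun z => δ (z / k) (z % k)) (Q * k)
  set tab : ℕ → ℕ := fun z => if z < Q * k then δ (z / k) (z % k) else 0 with htab'
  have htab_eq : ∀ q < Q, ∀ d < k, tab (q * k + d) = δ q d := by
    intro q hq d hd
    have h₁ : q * k + d < Q * k := by nlinarith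
    have h₂ : (q * k + d) / k = q := by
      rw [mul_comm, Nat.mul_add_div (by omega), Nat.div_eq_of_lt hd, add_zero]
    have h₃ : (q * k + d) % k = d := by
      rw [mul_comm, Nat.mul_add_mod, Nat.mod_eq_of_lt hd]
    simp only [htab', if_pos h₁, h₂, h₃]
  have key : ∀ n t : ℕ, t ≤ n → Nat.rec (motive := fun _ => ℕ) q₀
      (fun t r => if n / k ^ (n - 1 - t) = 0 then q₀ else tab (r * k + n / k ^ (n - 1 - t) % k)) t =
      st (n / k ^ (n - t)) := by
    intro n t
    induction t with
    | zero =>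
      intro _
      rw [Nat.sub_zero, Nat.div_eq_of_lt (Nat.lt_pow_self hk), hst₀]
      rfl
    | succ t ih =>
      intro ht
      simp only [ih (by omega)]
      rw [show n - 1 - t = n - (t + 1) by omega]
      split_ifs with h
      · rw [h, hst₀]
      · rw [hst _ h, Nat.div_div_eq_div_mul, ← pow_succ, show n - (t + 1) + 1 = n - t by omega]
        exact htab_eq _ (hstQ _) _ (Nat.mod_lt _ (by omega))
  have hy : PolyReg fun ρ => ρ 2 / k ^ (ρ 2 - 1 - ρ 0) :=
    comp₂ (op := fun n t => n / k ^ t) hdiv (var 2) ((var 2).pred.sub (var 0))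
  have hnext : PolyReg fun ρ => tab (ρ 1 * k + ρ 2 / k ^ (ρ 2 - 1 - ρ 0) % k) :=
    comp₁ htab (((var 1).mul (const k)).add (hy.mod (const k)))
  refine (natRec (G := fun _ => Q) (base := fun _ => q₀) (step := fun t r ρ =>
    if ρ 0 / k ^ (ρ 0 - 1 - t) = 0 then q₀ else tab (r * k + ρ 0 / k ^ (ρ 0 - 1 - t) % k))
    (var 0) (const q₀) (ifZero hy (const q₀) hnext) (.const Q) fun ρ i hi => ?_).congr fun ρ => ?_
  · exact (key (ρ 0) i hi).trans_le (hstQ _).le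
  · simpa using key (ρ 0) (ρ 0) le_rfl

/-- The digits of an automatic real are computable. -/
theorem PolyReg.automatic {k : ℕ} (hk : 2 ≤ k) (a : ℕ → ℤ)
    (A : FiniteAutomatonWithOutput (Fin k) ℤ)
    (hA : ∀ n : ℕ, ∀ w : List (Fin k), IsRadixExpansion k n w → A.eval w = a n) :
    PolyReg fun ρ => (a (ρ 0)).toNat := by
  have := A.finite_Q
  obtain ⟨Q, ⟨e⟩⟩ := Finite.exists_equiv_fin A.Q
  have hk0 : 0 < k := by omega
  have hQ : 0 < Q := (e A.start).pos
  -- the expansion of `n` and the state reached on it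
  let w : ℕ → List (Fin k) := fun n =>
    ((Nat.digits k n).reverse.map fun d => ⟨d % k, Nat.mod_lt _ hk0⟩)
  have hw : ∀ n, IsRadixExpansion k n (w n) := by
    intro n
    simp only [IsRadixExpansion, w, List.map_map]
    refine (List.map_congr_left fun d hd => ?_).trans (List.map_id _)
    simp [Nat.mod_eq_of_lt (Nat.digits_lt_base hk (List.mem_reverse.1 hd))]
  let st : ℕ → A.Q := fun n => (w n).foldl A.step A.start
  let δ : ℕ → ℕ → ℕ := fun q d =>
    if h : q < Q ∧ d < k then (e (A.step (e.symm ⟨q, h.1⟩) ⟨d, h.2⟩)).1 else 0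
  have hstate := digitAutomaton k Q (e A.start).1 hk (e A.start).2 δ
    (fun q hq d hd => by simp only [δ, dif_pos (And.intro hq hd)]; exact (e _).2)
    (fun n => (e (st n)).1) (by simp [st, w]) (fun n hn => by
      have h₁ : w n = w (n / k) ++ [⟨n % k, Nat.mod_lt _ hk0⟩] := by
        simp only [w]
        rw [Nat.digits_def' hk (Nat.pos_of_ne_zero hn)]
        simp
      have h₂ : (e (st (n / k))).1 < Q ∧ n % k < k := ⟨(e _).2, Nat.mod_lt _ hk0⟩
      simp only [δ, dif_pos h₂, Fin.eta, Equiv.symm_apply_apply]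
      simp only [st, h₁, List.foldl_append, List.foldl_cons, List.foldl_nil])
  have hout := table (fun q => if h : q < Q then (A.out (e.symm ⟨q, h⟩)).toNat else 0) Q
  refine (comp₁ (op := fun q => if q < Q then
    (if h : q < Q then (A.out (e.symm ⟨q, h⟩)).toNat else 0) else 0) hout hstate).congr fun ρ => ?_
  simp only [(e _).2, if_true, dif_pos, Fin.eta, Equiv.symm_apply_apply]
  rw [← hA _ _ (hw (ρ 0))]
  rfl

end StructuredTM

/-! ### Radix conversion by residues -/

namespace RadixConversion

open Finset StructuredTM

/-- The moduli are the primes larger than the base `b`. -/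
def IsModulus (b q : ℕ) : Prop := q.Prime ∧ b < q

instance (b : ℕ) : DecidablePred (IsModulus b) := fun _ => inferInstanceAs (Decidable (_ ∧ _))

/-- The moduli are divided into consecutive groups of `w` moduli; this is the index of the group
of `q`. -/
def group (b w q : ℕ) : ℕ := Nat.count (IsModulus b) q / w

/-- The product of the moduli below `K` in group `l`. -/
def groupProd (b w K l : ℕ) : ℕ :=
  ∏ q ∈ range K, if IsModulus b q ∧ group b w q = l then q else 1

/-- The residue modulo `p` of `∏ l < i, (P l - P l % b)`, where `P l` is the product of group `l`.
Both `P l % p` and `P l % b` are computed without computing `P l`; the summand `p > b` keeps the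
subtraction from truncating. -/
def numMod (b w K i p : ℕ) : ℕ :=
  prodMod p i fun l =>
    prodMod p K (fun q => if IsModulus b q ∧ group b w q = l then q else 1) + p -
      prodMod b K fun q => if IsModulus b q ∧ group b w q = l then q else 1

/-- A number congruent modulo `p` to `b ^ i` times the product of the moduli `≠ p` in the groups
below `i`. -/
def denMod (b w K i p : ℕ) : ℕ :=
  prodMod p K (fun q => if IsModulus b q ∧ group b w q < i ∧ q ≠ p then q else 1) *
    prodMod p i fun _ => b

/-- The coefficient of `1 / p` in the partial fraction expansion modulo `1` of
`∏ l < i, ⌊P l / b⌋ / P l`: the solution `c < p` of `c * den ≡ num` modulo `p`, written as a sum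
over all solutions. -/
def coef (b w K i p : ℕ) : ℕ :=
  ∑ c ∈ range p, if c * denMod b w K i p % p = numMod b w K i p then c else 0

/-- The sum of the binary digits of weight `2 ^ t` of the numbers `⌊2 ^ L * c / p⌋`, each counted
`a i` times, where `c` is the coefficient of `1 / p` in the expansion for `b ^ (-(i + 1))`. -/
def column (a : ℕ → ℕ) (b w K M L t : ℕ) : ℕ :=
  ∑ i ∈ range M, a i * ∑ p ∈ range K,
    if IsModulus b p ∧ group b w p < i + 1 then
      prodMod (2 * p) (L - t) (fun _ => 2) * coef b w K (i + 1) p % (2 * p) / p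
    else 0

/-- The carry into column `t` when the columns are added up, starting with the carry `E`. -/
def carry (u : ℕ → ℕ) (E t : ℕ) : ℕ :=
  Nat.rec (motive := fun _ => ℕ) E (fun t r => (r + u t) / 2) t

/-- The binary digit in position `t` of the sum. -/
def digit (u : ℕ → ℕ) (E t : ℕ) : ℕ := (carry u E t + u t) % 2

theorem polyPred_isModulus (b : ℕ) {q : (ℕ → ℕ) → ℕ} (hq : PolyReg q) :
    PolyPred fun ρ => IsModulus b (q ρ) := by
  have h : PolyPred fun ρ => IsModulus b (ρ 0) := by
    refine PolyPred.congr (((PolyPred.le (.const 2) (.var 0)).and (PolyPred.eq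
      (PolyReg.sum (F := fun d ρ => if 2 ≤ d ∧ ρ 0 % d = 0 then 1 else 0) (.var 0)
        (PolyReg.ite ((PolyPred.le (.const 2) (.var 0)).and
          (PolyPred.eq (PolyReg.mod (.var 1) (.var 0)) .zero)) (.const 1) .zero))
      .zero)).and (PolyPred.lt (.const b) (.var 0))) fun ρ => ?_
    rw [IsModulus]
    refine and_congr_left fun _ => ?_
    rw [Nat.prime_def, sum_eq_zero_iff]
    refine and_congr_right fun h2 => ⟨fun h m hm => ?_, fun h d hd => ?_⟩
    · rcases (Nat.le_of_dvd (by omega) hm).lt_or_eq with hlt | rfl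
      · have := h m (mem_range.2 hlt)
        have hm0 : m ≠ 0 := by rintro rfl; simp at hm; omega
        rw [Nat.dvd_iff_mod_eq_zero] at hm
        simp only [hm, and_true] at this
        split_ifs at this
        omega
      · exact Or.inr rfl
    · refine if_neg fun h' => ?_
      have := h d (Nat.dvd_of_mod_eq_zero h'.2)
      have := mem_range.1 hd
      omega
  exact h.comp₁ hq

theorem polyReg_group (b : ℕ) {w q : (ℕ → ℕ) → ℕ} (hw : PolyReg w) (hq : PolyReg q) :
    PolyReg fun ρ => group b (w ρ) (q ρ) := by
  refine PolyReg.div (PolyReg.congr (PolyReg.sum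
    (F := fun d _ => if IsModulus b d then 1 else 0) hq
    (PolyReg.ite (polyPred_isModulus b (.var 0)) (.const 1) .zero)) fun ρ => ?_) hw
  rw [Nat.count_eq_card_filter_range, card_filter]

theorem polyReg_coef (b : ℕ) {w K i p : (ℕ → ℕ) → ℕ} (hw : PolyReg w) (hK : PolyReg K)
    (hi : PolyReg i) (hp : PolyReg p) : PolyReg fun ρ => coef b (w ρ) (K ρ) (i ρ) (p ρ) := by
  have hgrp : ∀ {m : (ℕ → ℕ) → ℕ}, PolyReg m → PolyReg fun ρ => prodMod (m fun i => ρ (i + 1))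
      (K fun i => ρ (i + 1)) fun q =>
        if IsModulus b q ∧ group b (w fun i => ρ (i + 1)) q = ρ 0 then q else 1 := fun hm =>
    PolyReg.prodMod (F := fun q ρ =>
        if IsModulus b q ∧ group b (w fun i => ρ (i + 1)) q = ρ 0 then q else 1) hm.shift hK.shift
      (PolyReg.ite ((polyPred_isModulus b (.var 0)).and (PolyPred.eq
        (polyReg_group b hw.shift.shift (.var 0)) (.var 1))) (.var 0) (.const 1))
  have hnum : PolyReg fun ρ => numMod b (w ρ) (K ρ) (i ρ) (p ρ) :=
    PolyReg.prodMod hp hi (((hgrp hp).add hp.shift).sub (hgrp (PolyReg.const b)))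
  have hden : PolyReg fun ρ => denMod b (w ρ) (K ρ) (i ρ) (p ρ) :=
    (PolyReg.prodMod hp hK (PolyReg.ite ((polyPred_isModulus b (.var 0)).and
      ((PolyPred.lt (polyReg_group b hw.shift (.var 0)) hi.shift).and
        (PolyPred.eq (.var 0) hp.shift).not)) (.var 0) (.const 1))).mul
      (PolyReg.prodMod hp hi (.const b))
  exact PolyReg.sum hp (PolyReg.ite (PolyPred.eq (((PolyReg.var 0).mul hden.shift).mod hp.shift)
    hnum.shift) (.var 0) .zero)

theorem polyReg_column {a : ℕ → ℕ} (ha : PolyReg fun ρ => a (ρ 0)) (b : ℕ)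
    {w K M L t : (ℕ → ℕ) → ℕ} (hw : PolyReg w) (hK : PolyReg K) (hM : PolyReg M) (hL : PolyReg L)
    (ht : PolyReg t) : PolyReg fun ρ => column a b (w ρ) (K ρ) (M ρ) (L ρ) (t ρ) := by
  have h2 : PolyReg fun ρ => 2 * ρ 0 := (PolyReg.const 2).mul (.var 0)
  exact PolyReg.sum hM (PolyReg.mul ha
    (PolyReg.sum hK.shift (PolyReg.ite
      ((polyPred_isModulus b (.var 0)).and (PolyPred.lt
        (polyReg_group b hw.shift.shift (.var 0)) (PolyReg.succ (.var 1))))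
      ((PolyReg.mod ((PolyReg.prodMod h2 (hL.sub ht).shift.shift (.const 2)).mul
        (polyReg_coef b hw.shift.shift hK.shift.shift (PolyReg.succ (.var 1)) (.var 0)))
        h2).div (.var 0)) .zero)))

theorem carry_le {u : ℕ → ℕ} {C : ℕ} (hu : ∀ t, u t ≤ C) (E t : ℕ) : carry u E t ≤ E + C := by
  induction t with
  | zero => exact Nat.le_add_right _ _
  | succ t ih =>
    have := hu t
    simp only [carry] at ih ⊢
    omega

theorem column_le {a : ℕ → ℕ} {b : ℕ} (ha : ∀ i, a i ≤ b) (w K M L t : ℕ) :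
    column a b w K M L t ≤ M * (b * K) := by
  refine (sum_le_card_nsmul _ _ (b * K) fun i _ => Nat.mul_le_mul (ha _) ?_).trans
    (by rw [card_range, smul_eq_mul])
  refine (sum_le_card_nsmul _ _ 1 fun p _ => ?_).trans (by rw [card_range, smul_eq_mul, mul_one])
  split_ifs with h
  · have := Nat.div_lt_of_lt_mul (Nat.mod_lt
      (prodMod (2 * p) (L - t) (fun _ => 2) * coef b w K (i + 1) p)
      (show 0 < 2 * p by have := h.1.1.pos; omega) |>.trans_eq (mul_comm 2 p))
    omega
  · exact Nat.zero_le _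

theorem polyReg_digit {a : ℕ → ℕ} (ha : PolyReg fun ρ => a (ρ 0)) {b : ℕ} (hab : ∀ i, a i ≤ b)
    {w K M L E t : (ℕ → ℕ) → ℕ} (hw : PolyReg w) (hK : PolyReg K) (hM : PolyReg M)
    (hL : PolyReg L) (hE : PolyReg E) (ht : PolyReg t) :
    PolyReg fun ρ => digit (column a b (w ρ) (K ρ) (M ρ) (L ρ)) (E ρ) (t ρ) := by
  have hcarry : PolyReg fun ρ => carry (column a b (w ρ) (K ρ) (M ρ) (L ρ)) (E ρ) (t ρ) := by
    refine PolyReg.natRec (G := fun ρ => E ρ + M ρ * (b * K ρ))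
      (step := fun t r ρ => (r + column a b (w ρ) (K ρ) (M ρ) (L ρ) t) / 2) ht hE
      (((PolyReg.var 1).add (polyReg_column ha b hw.shift₂ hK.shift₂ hM.shift₂ hL.shift₂
        (.var 0))).div (.const 2)) (hE.bdd.add (hM.bdd.mul ((PolyBdd.const b).mul hK.bdd)))
      fun ρ i _ => ?_
    exact carry_le (fun t => column_le hab _ _ _ _ t) _ i
  exact (hcarry.add (polyReg_column ha b hw hK hM hL ht)).mod (.const 2)

end RadixConversion

namespace RadixConversion

open Finset StructuredTM

/-! ### The supply of moduli -/

/-- A weak form of Chebyshev's bound: there are at least `T` primes up to `8 * T ^ 2`. It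
follows from `2 ^ n ≤ (n + 1) * lcm (1, …, n)` and from `lcm (1, …, n) ≤ (n + 1) ^ π n`. -/
theorem le_primeCounting (T : ℕ) : T ≤ Nat.primeCounting (8 * T ^ 2) := by
  rcases Nat.eq_zero_or_pos T with rfl | hT
  · exact Nat.zero_le _
  by_contra! hlt
  set n := 8 * T ^ 2 with hn
  have h₁ := Chebyshev.two_pow_le_mul_lcmUpto n
  have h₂ : Nat.lcmUpto n ≤ (n + 1) ^ Nat.primeCounting n := by
    rw [Nat.lcmUpto_eq_prod_pow_log, ← Nat.primesLE_card_eq_primeCounting]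
    refine prod_le_pow_card _ _ _ fun p _ => ?_
    exact (Nat.pow_log_le_self p (by positivity)).trans (Nat.le_succ n)
  have h₃ : (n + 1) * Nat.lcmUpto n ≤ (n + 1) ^ T :=
    calc (n + 1) * Nat.lcmUpto n ≤ (n + 1) * (n + 1) ^ Nat.primeCounting n :=
          Nat.mul_le_mul_left _ h₂
      _ = (n + 1) ^ (Nat.primeCounting n + 1) := by ring
      _ ≤ (n + 1) ^ T := Nat.pow_le_pow_right (by omega) hlt
  have h₄ : n + 1 < 2 ^ (8 * T) := by
    have h : T + 1 ≤ 2 ^ T := Nat.lt_two_pow_self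
    calc n + 1 < 2 ^ 4 * (T + 1) ^ 2 := by rw [hn]; nlinarith
      _ ≤ 2 ^ (4 * T) * (2 ^ T) ^ 2 :=
          Nat.mul_le_mul (Nat.pow_le_pow_right (by norm_num) (by omega)) (Nat.pow_le_pow_left h 2)
      _ = 2 ^ (6 * T) := by rw [← pow_mul, ← pow_add]; congr 1; ring
      _ ≤ 2 ^ (8 * T) := Nat.pow_le_pow_right (by norm_num) (by omega)
  have h₅ : (n + 1) ^ T < 2 ^ n :=
    calc (n + 1) ^ T < (2 ^ (8 * T)) ^ T := Nat.pow_lt_pow_left h₄ hT.ne'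
      _ = 2 ^ n := by rw [← pow_mul, hn]; congr 1; ring
  omega

theorem le_count_isModulus (b T : ℕ) :
    T ≤ Nat.count (IsModulus b) (8 * T ^ 2 + 1) + (b + 1) := by
  refine (le_primeCounting T).trans ?_
  rw [← Nat.primesLE_card_eq_primeCounting, Nat.count_eq_card_filter_range]
  refine (card_le_card (t := (range (8 * T ^ 2 + 1)).filter (IsModulus b) ∪ range (b + 1))
    fun p hp => ?_).trans ((card_union_le _ _).trans_eq (by rw [card_range]))
  rw [Nat.mem_primesLE] at hp
  simp only [mem_union, mem_filter, mem_range, IsModulus, hp.2, true_and]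
  omega

theorem infinite_isModulus (b : ℕ) : (Set.ofPred (IsModulus b)).Infinite := by
  refine Set.infinite_of_not_bddAbove fun ⟨B, hB⟩ => ?_
  obtain ⟨p, hp, hprime⟩ := Nat.exists_infinite_primes (max B b + 1)
  have := hB (show IsModulus b p from ⟨hprime, by omega⟩)
  omega

theorem groupProd_eq (b w K l : ℕ) :
    groupProd b w K l = ∏ q ∈ (range K).filter fun q => IsModulus b q ∧ group b w q = l, q :=
  (prod_filter _ _).symm

theorem two_pow_le_groupProd {b w K M l : ℕ} (hK : M * w ≤ Nat.count (IsModulus b) K)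
    (hl : l < M) : 2 ^ w ≤ groupProd b w K l := by
  rw [groupProd_eq]
  have hinf := infinite_isModulus b
  have hcard : w ≤ ((range K).filter fun q => IsModulus b q ∧ group b w q = l).card := by
    refine (card_range w).ge.trans (card_le_card_of_injOn
      (fun j => Nat.nth (IsModulus b) (w * l + j)) (fun j hj => ?_)
      fun i _ j _ hij => by simpa using Nat.nth_injective hinf hij)
    have hj : j < w := by simpa using hj
    refine mem_filter.2
      ⟨mem_range.2 (Nat.nth_lt_of_lt_count ?_), Nat.nth_mem_of_infinite hinf _, ?_⟩
    · nlinarith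
    · rw [group, Nat.count_nth_of_infinite hinf, Nat.mul_add_div (by omega), Nat.div_eq_of_lt hj,
        add_zero]
  exact (Nat.pow_le_pow_right (by norm_num) hcard).trans
    (pow_card_le_prod _ _ _ fun q hq => (mem_filter.1 hq).2.1.1.two_le)

/-! ### Partial fractions -/

/-- The moduli below `K` in the groups below `i`. -/
def moduli (b w K i : ℕ) : Finset ℕ :=
  (range K).filter fun q => IsModulus b q ∧ group b w q < i

theorem isModulus_of_mem {b w K i q : ℕ} (h : q ∈ moduli b w K i) : IsModulus b q :=
  (mem_filter.1 h).2.1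

theorem prod_moduli (b w K i : ℕ) :
    ∏ q ∈ moduli b w K i, q = ∏ l ∈ range i, groupProd b w K l := by
  rw [← prod_fiberwise_of_maps_to (s := moduli b w K i) (t := range i) (g := group b w)
    (fun q hq => mem_range.2 (mem_filter.1 hq).2.2)]
  refine prod_congr rfl fun l hl => ?_
  rw [groupProd_eq, moduli, filter_filter]
  refine prod_congr (filter_congr fun q _ => ?_) fun _ _ => rfl
  have := mem_range.1 hl
  constructor
  · rintro ⟨⟨h₁, h₂⟩, h₃⟩
    exact ⟨h₁, h₃⟩
  · rintro ⟨h₁, h₂⟩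
    exact ⟨⟨h₁, by omega⟩, h₂⟩

theorem prod_modEq {p : ℕ} {s : Finset ℕ} {f g : ℕ → ℕ} (h : ∀ i ∈ s, f i ≡ g i [MOD p]) :
    ∏ i ∈ s, f i ≡ ∏ i ∈ s, g i [MOD p] := by
  rw [Nat.ModEq, prod_nat_mod, prod_nat_mod s p g, prod_congr rfl h]

theorem numMod_modEq {b p : ℕ} (hb : 0 < b) (hp : IsModulus b p) (w K i : ℕ) :
    numMod b w K i p ≡ ∏ l ∈ range i, (groupProd b w K l - groupProd b w K l % b) [MOD p] := by
  rw [numMod, prodMod_of_pos hp.1.pos]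
  refine (Nat.mod_modEq _ _).trans (prod_modEq fun l _ => ?_)
  rw [prodMod_of_pos hp.1.pos, prodMod_of_pos hb]
  change groupProd b w K l % p + p - groupProd b w K l % b ≡ _ [MOD p]
  set P := groupProd b w K l
  have h₁ : P % b < p := (Nat.mod_lt P hb).trans hp.2
  have h₂ : P % b ≤ P := Nat.mod_le _ _
  refine Nat.ModEq.add_right_cancel' (P % b) ?_
  rw [Nat.sub_add_cancel (by omega), Nat.sub_add_cancel h₂]
  simp [Nat.ModEq]

theorem denMod_modEq {b p : ℕ} (hp : IsModulus b p) (w K i : ℕ) :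
    denMod b w K i p ≡ (∏ q ∈ (moduli b w K i).erase p, q) * b ^ i [MOD p] := by
  rw [denMod, prodMod_of_pos hp.1.pos, prodMod_of_pos hp.1.pos, prod_const, card_range,
    ← prod_filter]
  have : (range K).filter (fun q => IsModulus b q ∧ group b w q < i ∧ q ≠ p) =
      (moduli b w K i).erase p := by
    ext q
    simp only [moduli, mem_filter, mem_erase]
    tauto
  rw [this]
  exact (Nat.mod_modEq _ _).mul (Nat.mod_modEq _ _)

theorem coprime_den {b p : ℕ} (hb : 0 < b) (hp : IsModulus b p) (w K i : ℕ) :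
    Nat.Coprime p ((∏ q ∈ (moduli b w K i).erase p, q) * b ^ i) := by
  refine Nat.Coprime.mul_right (Nat.Coprime.prod_right fun q hq => ?_) (Nat.Coprime.pow_right _ ?_)
  · rw [mem_erase] at hq
    exact (Nat.coprime_primes hp.1 (isModulus_of_mem hq.2).1).2 hq.1.symm
  · exact (Nat.Prime.coprime_iff_not_dvd hp.1).2 (Nat.not_dvd_of_pos_of_lt hb hp.2)

/-- The search for the numerator succeeds, and its result is the solution of the congruence. -/
theorem coef_spec {b p : ℕ} (hb : 0 < b) (hp : IsModulus b p) (w K i : ℕ) :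
    coef b w K i p < p ∧
    coef b w K i p * ((∏ q ∈ (moduli b w K i).erase p, q) * b ^ i) ≡
      ∏ l ∈ range i, (groupProd b w K l - groupProd b w K l % b) [MOD p] := by
  have hden := denMod_modEq hp w K i
  have hcop : Nat.Coprime p (denMod b w K i p) := by
    rw [Nat.Coprime, Nat.gcd_comm, hden.gcd_eq, Nat.gcd_comm]
    exact coprime_den hb hp w K i
  have hnum_lt : numMod b w K i p < p := by
    rw [numMod, prodMod_of_pos hp.1.pos]
    exact Nat.mod_lt _ hp.1.pos
  obtain ⟨m, -, hm⟩ := Nat.exists_mul_mod_eq_one_of_coprime hcop.symm hp.1.one_lt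
  -- the solution of the congruence
  set c := m * numMod b w K i p % p with hc
  have hcp : c < p := Nat.mod_lt _ hp.1.pos
  have hcsol : c * denMod b w K i p ≡ numMod b w K i p [MOD p] := by
    have h₁ : denMod b w K i p * m ≡ 1 [MOD p] := by
      rw [Nat.ModEq, hm, Nat.mod_eq_of_lt hp.1.one_lt]
    calc c * denMod b w K i p ≡ m * numMod b w K i p * denMod b w K i p [MOD p] :=
          (Nat.mod_modEq _ _).mul_right _
      _ = denMod b w K i p * m * numMod b w K i p := by ring
      _ ≡ 1 * numMod b w K i p [MOD p] := h₁.mul_right _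
      _ = numMod b w K i p := one_mul _
  have hcoef : coef b w K i p = c := by
    rw [coef, sum_eq_single c]
    · exact if_pos (Eq.trans hcsol (Nat.mod_eq_of_lt hnum_lt))
    · intro d hd hdc
      refine if_neg fun h => hdc ?_
      have h₁ : d * denMod b w K i p ≡ c * denMod b w K i p [MOD p] :=
        (show d * denMod b w K i p % p = _ % p by
          rw [h, hcsol, Nat.mod_eq_of_lt hnum_lt])
      have h₂ := Nat.ModEq.cancel_right_of_coprime hcop h₁
      rwa [Nat.ModEq, Nat.mod_eq_of_lt (mem_range.1 hd), Nat.mod_eq_of_lt hcp] at h₂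
    · exact fun h => absurd (mem_range.2 hcp) h
  rw [hcoef]
  exact ⟨hcp, (hden.mul_left c).symm.trans (hcsol.trans (numMod_modEq hb hp w K i))⟩

/-- Modulo `1`, the product of the fractions `⌊P l / b⌋ / P l` is a sum of fractions with small
denominators. -/
theorem exists_int_sum_coef {b : ℕ} (hb : 0 < b) (w K i : ℕ) :
    ∃ z : ℤ, ∑ p ∈ moduli b w K i, (coef b w K i p : ℝ) / p =
      ∏ l ∈ range i, ((groupProd b w K l / b : ℕ) : ℝ) / groupProd b w K l + z := by
  set S := moduli b w K i with hS
  set X : ℕ := ∏ l ∈ range i, groupProd b w K l / b with hX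
  have hmem : ∀ p ∈ S, IsModulus b p := fun p hp => isModulus_of_mem hp
  have hmod : ∀ p ∈ S, ∑ q ∈ S, coef b w K i q * ∏ r ∈ S.erase q, r ≡ X [MOD p] := by
    intro p hp
    have h₁ : ∑ q ∈ S, coef b w K i q * ∏ r ∈ S.erase q, r ≡
        coef b w K i p * ∏ r ∈ S.erase p, r [MOD p] := by
      rw [← add_sum_erase _ _ hp]
      refine (Nat.ModEq.add_left _ (Nat.modEq_zero_iff_dvd.2 (dvd_sum fun q hq => ?_)))
      rw [mem_erase] at hq
      exact (dvd_prod_of_mem (fun r => r) (mem_erase.2 ⟨hq.1.symm, hp⟩)).mul_left _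
    have h₂ : ∏ l ∈ range i, (groupProd b w K l - groupProd b w K l % b) = X * b ^ i := by
      have hpow : b ^ i = ∏ _l ∈ range i, b := by simp
      rw [hX, hpow, ← prod_mul_distrib]
      refine prod_congr rfl fun l _ => ?_
      rw [mul_comm]
      exact Nat.sub_eq_of_eq_add (Nat.div_add_mod _ _).symm
    have h₃ := (coef_spec hb (hmem p hp) w K i).2
    rw [h₂, ← mul_assoc] at h₃
    have hcop : Nat.gcd p (b ^ i) = 1 := (coprime_den hb (hmem p hp) w K i).coprime_mul_left_right
    exact h₁.trans (Nat.ModEq.cancel_right_of_coprime hcop h₃)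
  have hdvd : ∏ q ∈ S, (q : ℤ) ∣
      ((∑ p ∈ S, coef b w K i p * ∏ q ∈ S.erase p, q : ℕ) : ℤ) - (X : ℤ) := by
    refine prod_dvd_of_coprime (fun p hp q hq hpq => ?_) fun p hp =>
      (Nat.modEq_iff_dvd.1 (hmod p hp).symm)
    exact Nat.isCoprime_iff_coprime.2 ((Nat.coprime_primes (hmem p hp).1 (hmem q hq).1).2 hpq)
  obtain ⟨z, hz⟩ := hdvd
  refine ⟨z, ?_⟩
  have hSpos : (∏ q ∈ S, (q : ℝ)) ≠ 0 :=
    prod_ne_zero_iff.2 fun q hq => by exact_mod_cast (hmem q hq).1.ne_zero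
  have hden : ∏ l ∈ range i, (groupProd b w K l : ℝ) = ∏ q ∈ S, (q : ℝ) := by
    rw [← Nat.cast_prod, ← prod_moduli, Nat.cast_prod]
  have hz' : (∑ p ∈ S, (coef b w K i p : ℝ) * ∏ q ∈ S.erase p, (q : ℝ)) =
      X + (∏ q ∈ S, (q : ℝ)) * z := by
    have : ((∑ p ∈ S, (coef b w K i p : ℤ) * ∏ q ∈ S.erase p, (q : ℤ))) =
        X + (∏ q ∈ S, (q : ℤ)) * z := by
      rw [← hz]
      push_cast
      ring
    have := congrArg (Int.cast : ℤ → ℝ) this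
    push_cast at this
    exact this
  have hX' : (X : ℝ) = ∏ l ∈ range i, ((groupProd b w K l / b : ℕ) : ℝ) := by
    rw [hX, Nat.cast_prod]
  rw [prod_div_distrib, hden, ← hX', eq_comm, div_add' _ _ _ hSpos, div_eq_iff hSpos, sum_mul,
    mul_comm (z : ℝ), ← hz']
  refine sum_congr rfl fun p hp => ?_
  have hp0 : (p : ℝ) ≠ 0 := by exact_mod_cast (hmem p hp).1.ne_zero
  rw [← mul_prod_erase _ _ hp]
  field_simp

end RadixConversion

namespace RadixConversion

open Finset StructuredTM

/-! ### Addition by columns -/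

/-- The digits and the final carry of a column addition represent the sum of all columns and the
initial carry. -/
theorem sum_digit_add_carry (u : ℕ → ℕ) (E T : ℕ) :
    ∑ t ∈ range T, digit u E t * 2 ^ t + 2 ^ T * carry u E T =
      E + ∑ t ∈ range T, u t * 2 ^ t := by
  induction T with
  | zero => simp [carry]
  | succ T ih =>
    have h : carry u E T + u T = 2 * carry u E (T + 1) + digit u E T :=
      (Nat.div_add_mod _ 2).symm
    rw [sum_range_succ, sum_range_succ, ← add_assoc, ← ih]
    have h' : 2 ^ T * (carry u E T + u T) = 2 ^ T * (2 * carry u E (T + 1) + digit u E T) := by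
      rw [h]
    linarith [pow_succ 2 T, show 2 ^ T * (2 * carry u E (T + 1) + digit u E T) =
      2 ^ (T + 1) * carry u E (T + 1) + digit u E T * 2 ^ T by ring]

theorem digit_lt_two (u : ℕ → ℕ) (E t : ℕ) : digit u E t < 2 := Nat.mod_lt _ (by norm_num)

theorem sum_lt_two_pow {d : ℕ → ℕ} (hd : ∀ t, d t < 2) (T : ℕ) :
    ∑ t ∈ range T, d t * 2 ^ t < 2 ^ T := by
  induction T with
  | zero => simp
  | succ T ih =>
    rw [sum_range_succ, pow_succ]
    have := Nat.mul_le_mul_right (2 ^ T) (Nat.le_of_lt_succ (hd T))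
    omega

/-- The binary digits of `⌊2 ^ L * c / p⌋`, obtained by long division of `c` by `p`. -/
theorem sum_long_division {c p : ℕ} (hc : c < p) (L : ℕ) :
    ∑ t ∈ range L, 2 ^ (L - t) * c % (2 * p) / p * 2 ^ t = 2 ^ L * c / p := by
  induction L with
  | zero => simp [Nat.div_eq_of_lt hc]
  | succ L ih =>
    rw [sum_range_succ', Nat.sub_zero, pow_zero, mul_one, mul_comm 2 p, Nat.mod_mul_right_div_self]
    have h₁ : ∀ t ∈ range L, 2 ^ (L + 1 - (t + 1)) * c % (p * 2) / p * 2 ^ (t + 1) =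
        2 * (2 ^ (L - t) * c % (2 * p) / p * 2 ^ t) := by
      intro t _
      rw [Nat.add_sub_add_right, mul_comm p 2, pow_succ]
      ring
    rw [sum_congr rfl h₁, ← mul_sum, ih]
    have h₂ : 2 ^ (L + 1) * c / p / 2 = 2 ^ L * c / p := by
      rw [Nat.div_div_eq_div_mul, pow_succ, mul_comm p 2, mul_comm (2 ^ L) 2, mul_assoc,
        Nat.mul_div_mul_left _ _ (by norm_num)]
    have := Nat.div_add_mod (2 ^ (L + 1) * c / p) 2
    rw [h₂] at this
    exact this

theorem sum_column {b : ℕ} (hb : 0 < b) (a : ℕ → ℕ) (w K M L : ℕ) :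
    ∑ t ∈ range L, column a b w K M L t * 2 ^ t =
      ∑ i ∈ range M, a i * ∑ p ∈ moduli b w K (i + 1), 2 ^ L * coef b w K (i + 1) p / p := by
  have h : ∀ t, column a b w K M L t = ∑ i ∈ range M, a i * ∑ p ∈ moduli b w K (i + 1),
      2 ^ (L - t) * coef b w K (i + 1) p % (2 * p) / p := by
    intro t
    refine sum_congr rfl fun i _ => ?_
    rw [← sum_filter]
    refine congrArg _ (sum_congr rfl fun p hp => ?_)
    have hp0 : 0 < 2 * p := by have := (isModulus_of_mem hp).1.pos; omega
    rw [prodMod_of_pos hp0, prod_const, card_range, Nat.mod_mul_mod]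
  simp_rw [h, sum_mul]
  rw [sum_comm]
  refine sum_congr rfl fun i _ => ?_
  simp_rw [mul_assoc, ← mul_sum, sum_mul]
  rw [sum_comm]
  refine congrArg _ (sum_congr rfl fun p hp => ?_)
  exact sum_long_division (coef_spec hb (isModulus_of_mem hp) w K (i + 1)).1 L

/-! ### Error estimates -/

/-- The rational approximation of `b ^ (-i)`. -/
noncomputable def approx (b w K i : ℕ) : ℝ :=
  ∏ l ∈ range i, ((groupProd b w K l / b : ℕ) : ℝ) / groupProd b w K l

theorem approx_nonneg (b w K i : ℕ) : 0 ≤ approx b w K i :=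
  prod_nonneg fun _ _ => by positivity

theorem factor_bounds {b : ℕ} (hb : 0 < b) {P w : ℕ} (hP : 2 ^ w ≤ P) :
    ((P / b : ℕ) : ℝ) / P ≤ 1 / b ∧ 1 / (b : ℝ) - (2 ^ w)⁻¹ ≤ ((P / b : ℕ) : ℝ) / P := by
  have hP0 : (0 : ℝ) < P := by exact_mod_cast (Nat.two_pow_pos w).trans_le hP
  have hb0 : (0 : ℝ) < b := by exact_mod_cast hb
  have hb1 : (1 : ℝ) ≤ b := by exact_mod_cast hb
  constructor
  · rw [div_le_iff₀ hP0]
    have := Nat.cast_div_le (α := ℝ) (m := P) (n := b)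
    rwa [one_div_mul_eq_div]
  · have h₁ : (P : ℝ) / b - 1 ≤ (P / b : ℕ) := by
      have h : (P : ℝ) < b * ((P / b : ℕ) + 1) := by
        exact_mod_cast Nat.lt_mul_div_succ P hb
      rw [sub_le_iff_le_add, div_le_iff₀ hb0]
      linarith
    have h₂ : (P : ℝ)⁻¹ ≤ (2 ^ w)⁻¹ := inv_anti₀ (by positivity) (by exact_mod_cast hP)
    rw [le_div_iff₀ hP0, sub_mul]
    have h₃ : 1 ≤ (2 ^ w : ℝ)⁻¹ * P := by
      rw [inv_mul_eq_div, le_div_iff₀ (by positivity), one_mul]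
      exact_mod_cast hP
    rw [one_div_mul_eq_div]
    linarith

theorem approx_bounds {b : ℕ} (hb : 0 < b) {w K M : ℕ}
    (hK : M * w ≤ Nat.count (IsModulus b) K) {i : ℕ} (hi : i ≤ M) :
    approx b w K i ≤ 1 / (b : ℝ) ^ i ∧
      1 / (b : ℝ) ^ i - i * (2 ^ w)⁻¹ ≤ approx b w K i := by
  have hb1 : (1 : ℝ) ≤ b := by exact_mod_cast hb
  induction i with
  | zero => simp [approx]
  | succ i ih =>
    obtain ⟨h₁, h₂⟩ := ih (by omega)
    obtain ⟨h₃, h₄⟩ := factor_bounds hb (two_pow_le_groupProd (l := i) hK (by omega))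
    have hrec : approx b w K (i + 1) =
        approx b w K i * (((groupProd b w K i / b : ℕ) : ℝ) / groupProd b w K i) :=
      prod_range_succ _ _
    set f := ((groupProd b w K i / b : ℕ) : ℝ) / groupProd b w K i
    have hf : 0 ≤ f := by positivity
    have hε : (0 : ℝ) ≤ (2 ^ w)⁻¹ := by positivity
    have hA := approx_nonneg b w K i
    have hle1 : 1 / (b : ℝ) ^ i ≤ 1 := by
      rw [div_le_one (by positivity)]
      exact one_le_pow₀ hb1
    have hle2 : 1 / (b : ℝ) ≤ 1 := by
      rw [div_le_one (by positivity)]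
      exact hb1
    have hmul : 1 / (b : ℝ) ^ (i + 1) = 1 / (b : ℝ) ^ i * (1 / b) := by
      rw [pow_succ]; field_simp
    rw [hrec, hmul]
    push_cast
    constructor
    · exact mul_le_mul h₁ h₃ hf (by positivity)
    · -- `x y - A f = (x - A) y + A (y - f)` for `x = b⁻ⁱ`, `y = b⁻¹`
      have e₁ : (1 / (b : ℝ) ^ i - approx b w K i) * (1 / b) ≤ i * (2 ^ w)⁻¹ * 1 :=
        mul_le_mul (by linarith) hle2 (by positivity) (by positivity)
      have e₂ : approx b w K i * (1 / b - f) ≤ 1 * (2 ^ w)⁻¹ :=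
        mul_le_mul (by linarith) (by linarith) (by linarith) (by norm_num)
      linarith

/-- The number whose binary expansion is produced: the sum of the columns modulo `2 ^ L`. -/
def value (a : ℕ → ℕ) (b w K M L E : ℕ) : ℕ :=
  ∑ t ∈ range L, digit (column a b w K M L) E t * 2 ^ t

/-- Rounding all summands down changes their sum by at most `E`, and starting with the carry `E`
makes the computed sum an upper bound. As the exact sum stays below `1 - b ^ (-M)` modulo `1`, the
result does not wrap around. -/
theorem value_bounds {b : ℕ} (hb : 2 ≤ b) {a : ℕ → ℕ} (ha : ∀ i, a i < b) {w K M L : ℕ}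
    (hK : M * w ≤ Nat.count (IsModulus b) K)
    (hL : M * (b * K) * b ^ M < 2 ^ L) :
    ∑ i ∈ range M, a i * approx b w K (i + 1) ≤ value a b w K M L (M * (b * K)) / 2 ^ L ∧
    (value a b w K M L (M * (b * K)) : ℝ) / 2 ^ L ≤
      ∑ i ∈ range M, a i * approx b w K (i + 1) + (M * (b * K) : ℕ) / 2 ^ L := by
  set E := M * (b * K) with hE
  set y := ∑ i ∈ range M, a i * approx b w K (i + 1) with hy
  set D := value a b w K M L E with hD
  set k := carry (column a b w K M L) E L with hk
  have hb0 : 0 < b := by omega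
  have hbR : (2 : ℝ) ≤ b := by exact_mod_cast hb
  have hpos : (0 : ℝ) < 2 ^ L := by positivity
  set s : ℝ := ∑ i ∈ range M, a i * ∑ p ∈ moduli b w K (i + 1), (coef b w K (i + 1) p : ℝ) / p
    with hs
  set T : ℕ := ∑ i ∈ range M, a i * ∑ p ∈ moduli b w K (i + 1), 2 ^ L * coef b w K (i + 1) p / p
    with hT
  have hsum : D + 2 ^ L * k = E + T := by
    rw [hT, ← sum_column hb0]
    exact sum_digit_add_carry _ _ _
  -- the partial fractions represent `y` modulo `1`
  obtain ⟨z, hz⟩ : ∃ z : ℤ, s = y + z := by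
    choose z hz using fun i => exists_int_sum_coef hb0 w K (i + 1)
    refine ⟨∑ i ∈ range M, a i * z i, ?_⟩
    rw [hs, hy]
    push_cast
    rw [← sum_add_distrib]
    refine sum_congr rfl fun i _ => ?_
    rw [hz, mul_add]
    rfl
  -- effect of rounding down
  have hT₁ : (T : ℝ) ≤ 2 ^ L * s := by
    rw [hT, hs, mul_sum]
    push_cast
    refine sum_le_sum fun i _ => ?_
    rw [mul_left_comm]
    refine mul_le_mul_of_nonneg_left ?_ (Nat.cast_nonneg _)
    rw [mul_sum]
    refine sum_le_sum fun p _ => ?_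
    have := Nat.cast_div_le (α := ℝ) (m := 2 ^ L * coef b w K (i + 1) p) (n := p)
    push_cast at this
    rwa [mul_div_assoc] at this
  have hT₂ : 2 ^ L * s ≤ T + E := by
    have h : ∀ i ∈ range M, (2 : ℝ) ^ L * (a i * ∑ p ∈ moduli b w K (i + 1),
        (coef b w K (i + 1) p : ℝ) / p) ≤
        a i * ∑ p ∈ moduli b w K (i + 1), ((2 ^ L * coef b w K (i + 1) p / p : ℕ) : ℝ) +
          b * K := by
      intro i _
      have h₁ : (2 : ℝ) ^ L * ∑ p ∈ moduli b w K (i + 1), (coef b w K (i + 1) p : ℝ) / p ≤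
          ∑ p ∈ moduli b w K (i + 1), ((2 ^ L * coef b w K (i + 1) p / p : ℕ) : ℝ) + K := by
        have hcard : ((moduli b w K (i + 1)).card : ℝ) ≤ K := by
          exact_mod_cast (card_filter_le _ _).trans_eq (card_range K)
        rw [mul_sum]
        refine le_trans (sum_le_sum (g := fun p =>
          ((2 ^ L * coef b w K (i + 1) p / p : ℕ) : ℝ) + 1) fun p hp => ?_) ?_
        · have hp0 := (isModulus_of_mem hp).1.pos
          have h := Nat.lt_mul_div_succ (2 ^ L * coef b w K (i + 1) p) hp0
          have h' : (2 : ℝ) ^ L * coef b w K (i + 1) p <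
              p * ((2 ^ L * coef b w K (i + 1) p / p : ℕ) + 1) := by exact_mod_cast h
          rw [← mul_div_assoc, div_le_iff₀ (by exact_mod_cast hp0)]
          linarith
        · rw [sum_add_distrib, sum_const, nsmul_eq_mul, mul_one]
          linarith
      have ha' : (a i : ℝ) ≤ b := by exact_mod_cast (ha i).le
      have hK0 : (0 : ℝ) ≤ K := by positivity
      calc _ = (a i : ℝ) * ((2 : ℝ) ^ L * ∑ p ∈ moduli b w K (i + 1),
            (coef b w K (i + 1) p : ℝ) / p) := by ring
        _ ≤ a i * (∑ p ∈ moduli b w K (i + 1), ((2 ^ L * coef b w K (i + 1) p / p : ℕ) : ℝ) + K) :=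
          mul_le_mul_of_nonneg_left h₁ (by positivity)
        _ ≤ _ := by rw [mul_add]; nlinarith
    rw [hs, mul_sum]
    refine (sum_le_sum h).trans_eq ?_
    rw [sum_add_distrib, sum_const, card_range, nsmul_eq_mul, hT, hE]
    push_cast
    rfl
  -- bounds on `y`
  have hy0 : 0 ≤ y := sum_nonneg fun i _ => mul_nonneg (by positivity) (approx_nonneg _ _ _ _)
  have hy1 : y ≤ 1 - 1 / (b : ℝ) ^ M := by
    have h : ∀ m, ∑ i ∈ range m, ((b : ℝ) - 1) * (1 / (b : ℝ) ^ (i + 1)) =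
        1 - 1 / (b : ℝ) ^ m := by
      intro m
      induction m with
      | zero => simp
      | succ m ih =>
        rw [sum_range_succ, ih, pow_succ]
        have : (b : ℝ) ≠ 0 := by positivity
        field_simp
        ring
    rw [← h M]
    refine sum_le_sum fun i hi => ?_
    have hai : (a i : ℝ) ≤ b - 1 := by
      have : (a i : ℝ) + 1 ≤ b := by exact_mod_cast ha i
      linarith
    exact mul_le_mul hai (approx_bounds hb0 hK (by have := mem_range.1 hi; omega)).1
      (approx_nonneg _ _ _ _) (by linarith)
  have hE1 : (E : ℝ) < 2 ^ L * (1 / (b : ℝ) ^ M) := by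
    rw [mul_one_div, lt_div_iff₀ (by positivity)]
    exact_mod_cast hL
  have hD1 : (D : ℝ) < 2 ^ L := by
    exact_mod_cast sum_lt_two_pow (digit_lt_two _ _) L
  have hD0 : (0 : ℝ) ≤ D := by positivity
  have hsumR : (D : ℝ) + 2 ^ L * k = E + T := by exact_mod_cast hsum
  -- there is no wrap-around
  have hzk : (z : ℝ) = k := by
    have e₁ : (2 : ℝ) ^ L * (k - z) < 2 ^ L := by nlinarith
    have e₂ : -(2 : ℝ) ^ L < 2 ^ L * (k - z) := by nlinarith
    have e₃ : ((k : ℤ) - z : ℝ) < 1 := by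
      push_cast; exact lt_of_mul_lt_mul_left (by linarith) hpos.le
    have e₄ : (-1 : ℝ) < ((k : ℤ) - z : ℝ) := by
      push_cast; exact lt_of_mul_lt_mul_left (by linarith) hpos.le
    have e₅ : (k : ℤ) - z < 1 := by exact_mod_cast e₃
    have e₆ : -1 < (k : ℤ) - z := by exact_mod_cast e₄
    have : z = k := by omega
    rw [this]
    simp
  rw [hz, mul_add, hzk] at hT₁ hT₂
  constructor
  · rw [le_div_iff₀ hpos]
    linarith
  · rw [div_le_iff₀ hpos, add_mul, div_mul_cancel₀ _ hpos.ne']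
    linarith

end RadixConversion

namespace RadixConversion

open Finset StructuredTM

/-- The truncated sum with approximate powers of `b` is below the exact value; the error has a part
from the approximation and a part from the truncation. -/
theorem hasSum_approx_bounds {b : ℕ} (hb : 2 ≤ b) {a : ℕ → ℕ} (ha : ∀ i, a i < b) {w K M : ℕ}
    (hK : M * w ≤ Nat.count (IsModulus b) K) {y : ℝ}
    (hy : HasSum (fun i => (a i : ℝ) / (b : ℝ) ^ (i + 1)) y) :
    ∑ i ∈ range M, a i * approx b w K (i + 1) ≤ y ∧
    y ≤ ∑ i ∈ range M, a i * approx b w K (i + 1) + (b * M ^ 2 : ℕ) * (2 ^ w)⁻¹ +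
      1 / (b : ℝ) ^ M := by
  have hb0 : 0 < b := by omega
  have hbR : (2 : ℝ) ≤ b := by exact_mod_cast hb
  have hε : (0 : ℝ) ≤ (2 ^ w)⁻¹ := by positivity
  have htail := (hasSum_nat_add_iff' (f := fun i => (a i : ℝ) / (b : ℝ) ^ (i + 1)) M).2 hy
  have htail0 := htail.nonneg fun i => by positivity
  have hgeom : HasSum (fun i : ℕ => ((b : ℝ) - 1) / (b : ℝ) ^ (i + M + 1)) (1 / (b : ℝ) ^ M) := by
    have h := (hasSum_geometric_of_lt_one (r := 1 / (b : ℝ)) (by positivity)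
      (by rw [div_lt_one (by positivity)]; linarith)).mul_left (((b : ℝ) - 1) / (b : ℝ) ^ (M + 1))
    have hb1 : (b : ℝ) ≠ 0 := by positivity
    have hb2 : (b : ℝ) - 1 ≠ 0 := by linarith
    have h₁ : (1 : ℝ) / (b : ℝ) ^ M =
        ((b : ℝ) - 1) / (b : ℝ) ^ (M + 1) * (1 - 1 / (b : ℝ))⁻¹ := by
      rw [one_sub_div hb1, inv_div, pow_succ]
      field_simp
    have h₂ : ∀ i : ℕ, ((b : ℝ) - 1) / (b : ℝ) ^ (i + M + 1) =
        ((b : ℝ) - 1) / (b : ℝ) ^ (M + 1) * (1 / (b : ℝ)) ^ i := by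
      intro i
      rw [one_div_pow, div_mul_div_comm, mul_one, ← pow_add]
      congr 2
      ring
    rw [h₁]
    simpa only [h₂] using h
  have htail1 := hasSum_le (fun i => by
    have : (a (i + M) : ℝ) + 1 ≤ b := by exact_mod_cast ha (i + M)
    exact div_le_div_of_nonneg_right (by linarith) (by positivity)) htail hgeom
  have hterm : ∀ i ∈ range M, (a i : ℝ) * approx b w K (i + 1) ≤ (a i : ℝ) / (b : ℝ) ^ (i + 1) ∧
      (a i : ℝ) / (b : ℝ) ^ (i + 1) ≤ a i * approx b w K (i + 1) + (b * M : ℕ) * (2 ^ w)⁻¹ := by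
    intro i hi
    have hi := mem_range.1 hi
    obtain ⟨h₁, h₂⟩ := approx_bounds hb0 hK (show i + 1 ≤ M by omega)
    have ha0 : (0 : ℝ) ≤ a i := Nat.cast_nonneg _
    rw [div_eq_mul_one_div]
    refine ⟨mul_le_mul_of_nonneg_left h₁ ha0, ?_⟩
    have h₃ : (a i : ℝ) * ((i + 1 : ℕ) * (2 ^ w)⁻¹) ≤ (b * M : ℕ) * (2 ^ w)⁻¹ := by
      rw [← mul_assoc]
      refine mul_le_mul_of_nonneg_right ?_ hε
      exact_mod_cast Nat.mul_le_mul (ha i).le (show i + 1 ≤ M by omega)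
    nlinarith
  have hlow := sum_le_sum fun i hi => (hterm i hi).1
  have hup := sum_le_sum fun i hi => (hterm i hi).2
  rw [sum_add_distrib, sum_const, card_range, nsmul_eq_mul] at hup
  have : (M : ℝ) * ((b * M : ℕ) * (2 ^ w)⁻¹) = (b * M ^ 2 : ℕ) * (2 ^ w)⁻¹ := by
    push_cast; ring
  constructor <;> linarith

/-! ### The choice of the parameters -/

/-- The number of base-`b` digits used for precision `2 ^ (-n)`. -/
def numDigits (n : ℕ) : ℕ := n + 2

/-- The number of moduli in a group. It is so large that `b * numDigits n ^ 2` errors of size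
`2 ^ (-groupSize b n)` add up to at most `2 ^ (-(n + 2))`. -/
def groupSize (b n : ℕ) : ℕ := n + 2 + b * numDigits n ^ 2

/-- All moduli used are below this number. There are enough primes for `numDigits n` complete groups
even after the primes up to `b` have been discarded. -/
def modulusBound (b n : ℕ) : ℕ := 8 * (numDigits n * groupSize b n + (b + 1)) ^ 2 + 1

/-- A bound for the total rounding error of the summands, in units of the last place. -/
def roundingBound (b n : ℕ) : ℕ := numDigits n * (b * modulusBound b n)

/-- The number of binary digits computed. It is so large that the rounding error is below
`b ^ (-numDigits n)`. -/
def precision (b n : ℕ) : ℕ := numDigits n * b + roundingBound b n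

/-- The binary digit of weight `2 ^ (t - precision b n)` of the approximation. -/
def outDigit (a : ℕ → ℕ) (b n t : ℕ) : ℕ :=
  digit (column a b (groupSize b n) (modulusBound b n) (numDigits n) (precision b n))
    (roundingBound b n) t

theorem polyReg_parameters (b : ℕ) :
    PolyReg (fun ρ => groupSize b (ρ 0)) ∧ PolyReg (fun ρ => modulusBound b (ρ 0)) ∧
    PolyReg (fun ρ => numDigits (ρ 0)) ∧ PolyReg (fun ρ => precision b (ρ 0)) ∧
    PolyReg (fun ρ => roundingBound b (ρ 0)) := by
  have sq : ∀ {f : (ℕ → ℕ) → ℕ}, PolyReg f → PolyReg fun ρ => f ρ ^ 2 := fun hf =>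
    (hf.mul hf).congr fun _ => (sq _).symm
  have hM : PolyReg fun ρ => numDigits (ρ 0) := (PolyReg.var 0).succ.succ
  have hw : PolyReg fun ρ => groupSize b (ρ 0) := hM.add ((PolyReg.const b).mul (sq hM))
  have hK : PolyReg fun ρ => modulusBound b (ρ 0) :=
    ((PolyReg.const 8).mul (sq ((hM.mul hw).add (.const (b + 1))))).succ
  have hE : PolyReg fun ρ => roundingBound b (ρ 0) := hM.mul ((PolyReg.const b).mul hK)
  exact ⟨hw, hK, hM, (hM.mul (.const b)).add hE, hE⟩

theorem polyReg_outDigit {a : ℕ → ℕ} (ha : PolyReg fun ρ => a (ρ 0)) {b : ℕ}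
    (hab : ∀ i, a i ≤ b) : PolyReg fun ρ => outDigit a b (ρ 0) (ρ 1) := by
  obtain ⟨hw, hK, hM, hL, hE⟩ := polyReg_parameters b
  exact polyReg_digit ha hab hw hK hM hL hE (.var 1)

theorem le_precision {b : ℕ} (hb : 2 ≤ b) (n : ℕ) : n + 2 ≤ precision b n := by
  simp only [precision, numDigits]
  nlinarith

theorem outDigit_approximates {b : ℕ} (hb : 2 ≤ b) {a : ℕ → ℕ} (ha : ∀ i, a i < b) {y : ℝ}
    (hy : HasSum (fun i => (a i : ℝ) / (b : ℝ) ^ (i + 1)) y) (n : ℕ) :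
    |(∑ t ∈ range (precision b n), outDigit a b n t * 2 ^ t : ℕ) / (2 : ℝ) ^ precision b n - y| ≤
      3 * (2 ^ (n + 2))⁻¹ := by
  set M := numDigits n with hM
  set w := groupSize b n with hw
  set K := modulusBound b n with hK
  set E := roundingBound b n with hE
  set L := precision b n with hL
  have hbR : (2 : ℝ) ≤ b := by exact_mod_cast hb
  have hcount : M * w ≤ Nat.count (IsModulus b) K := by
    have := le_count_isModulus b (M * w + (b + 1))
    change M * w ≤ Nat.count (IsModulus b) (8 * (M * w + (b + 1)) ^ 2 + 1)
    omega
  have hbM : b ^ M ≤ 2 ^ (M * b) := by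
    rw [mul_comm, pow_mul]
    exact Nat.pow_le_pow_left Nat.lt_two_pow_self.le M
  have hEL : E * b ^ M < 2 ^ L := by
    rw [hL, precision, pow_add, mul_comm]
    exact Nat.mul_lt_mul_of_le_of_lt hbM Nat.lt_two_pow_self (by positivity)
  obtain ⟨h₁, h₂⟩ := value_bounds hb ha hcount hEL
  obtain ⟨h₃, h₄⟩ := hasSum_approx_bounds hb ha hcount hy
  have hv : ∑ t ∈ range L, outDigit a b n t * 2 ^ t = value a b w K M L (M * (b * K)) := rfl
  rw [hv]
  have e₁ : 1 / (b : ℝ) ^ M ≤ (2 ^ (n + 2))⁻¹ := by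
    rw [one_div]
    exact inv_anti₀ (by positivity) (pow_le_pow_left₀ (by norm_num) hbR _)
  have e₂ : ((M * (b * K) : ℕ) : ℝ) / 2 ^ L ≤ 1 / (b : ℝ) ^ M := by
    rw [div_le_div_iff₀ (by positivity) (by positivity), one_mul]
    exact_mod_cast hEL.le
  have e₃ : ((b * M ^ 2 : ℕ) : ℝ) * (2 ^ w)⁻¹ ≤ (2 ^ (n + 2))⁻¹ := by
    have h : ((b * M ^ 2 : ℕ) : ℝ) ≤ 2 ^ (b * M ^ 2) := by
      exact_mod_cast (Nat.lt_two_pow_self (n := b * M ^ 2)).le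
    rw [hw, groupSize, pow_add, mul_inv, mul_left_comm, ← div_eq_mul_inv]
    exact mul_le_of_le_one_right (by positivity) ((div_le_one (by positivity)).2 h)
  rw [abs_le]
  constructor
  · linarith
  · linarith

end RadixConversion

namespace StructuredTM

/-! ### A program printing computable digits -/

variable {n B pos : ℕ} {R : ℕ → ℕ}

/-- Print a fixed string. -/
def Cmd.print : List DyadicSymbol → Cmd
  | [] => .skip
  | d :: l => .seq (.act (.emit d)) (Cmd.print l)

theorem RegExec.print (l : List DyadicSymbol) : ∀ o, RegExec n B pos (.print l) R o R (o ++ l) := by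
  induction l with
  | nil => intro o; simpa [Cmd.print] using RegExec.skip
  | cons d l ih =>
    intro o
    have := (RegExec.emit (n := n) (B := B) (pos := pos) (R := R) (o := o) d).seq (ih (o ++ [d]))
    simpa [Cmd.print] using this

theorem init_eq : Mem.init = regMem 1 (fun _ => 0) [] := by
  ext j z
  · rfl
  · cases z <;> simp [Mem.init, regMem, encode]
  · rfl
  · rfl

/-- Store the length of the input in register `0`. -/
def Cmd.readInput : Cmd := .loop .input (.seq (.act .next) (.inc 0))

theorem exec_readInput (hB : n < 2 ^ B) :
    Exec n B .readInput Mem.init (regMem (n + 1) (fun i => if i = 0 then n else 0) []) := by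
  have hloop : ∀ m, m ≤ n → Exec n B .readInput
      (regMem (n - m + 1) (fun i => if i = 0 then n - m else 0) [])
      (regMem (n + 1) (fun i => if i = 0 then n else 0) []) := by
    intro m
    induction m with
    | zero =>
      intro _
      exact Exec.loopDone (by simp [Test.eval, regMem, MultitapeTM.readInput])
    | succ m ih =>
      intro hm
      refine Exec.loopStep ?_ (Exec.seq (Exec.act _ _ ?_) ?_) (ih (by omega))
      · simp [Test.eval, regMem, MultitapeTM.readInput]; omega
      · exact fun j => by simp [Atom.apply, regMem]
      · have h : Atom.apply n (regMem (n - (m + 1) + 1)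
            (fun i => if i = 0 then n - (m + 1) else 0) []) .next =
            regMem (n - m + 1) (fun i => if i = 0 then n - (m + 1) else 0) [] := by
          simp only [Atom.apply, regMem]
          congr 1
          omega
        rw [h]
        refine RegExec.inc 0 (by simp; omega) ?_
        funext i
        simp only [Function.update_apply]
        split_ifs <;> omega
  have := hloop n le_rfl
  rw [init_eq]
  simpa using this

/-- There is a program which, on an input of length `n`, prints the string `pre` and then for
`t = prec n - 1, …, 0` one of two symbols, depending on whether `dig n t = 0`. -/
theorem exists_printer (pre : List DyadicSymbol) (s₀ s₁ : DyadicSymbol) {prec : ℕ → ℕ}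
    {dig : ℕ → ℕ → ℕ} (hprec : PolyReg fun ρ => prec (ρ 0))
    (hdig : PolyReg fun ρ => dig (ρ 0) (ρ 1)) :
    ∃ (p : Cmd) (c : ℕ), ∀ n B : ℕ, (n + 2) ^ c ≤ 2 ^ B → ∃ R : ℕ → ℕ,
      Exec n B p .init (regMem (n + 1) R (pre ++ (List.range (prec n)).reverse.map
        fun t => if dig n t = 0 then s₀ else s₁)) := by
  obtain ⟨a, ha⟩ := hprec.bdd
  obtain ⟨b, hb⟩ := hdig.bdd
  -- register 0 holds `n`, register 1 the position `t`, register 2 is always zero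
  obtain ⟨p, c, hp⟩ := hprec.prog (fun i => if i = 0 then 0 else 2) 3 1
    (fun i => by split_ifs <;> omega) (by omega) (fun i => by split_ifs <;> omega)
  obtain ⟨q, d, hq⟩ := hdig.prog (fun i => if i = 0 then 0 else if i = 1 then 1 else 2) 4 3
    (fun i => by split_ifs <;> omega) (by omega) (fun i => by split_ifs <;> omega)
  refine ⟨.seq .readInput (.seq (.print pre) (.seq p (.countdown 1 (.seq q
    (.ite (.nonzero 3) (.seq (.clear 3) (.act (.emit s₁))) (.act (.emit s₀))))))),
    c + (a + 3) * (b + d + 1) + (a + 3), fun n B hB => ?_⟩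
  set m := prec n with hm
  have hma : m ≤ (n + 2) ^ a := by
    have := ha (fun i => if i = 0 then n else 0) n (fun i => by split_ifs <;> omega)
    simpa using this
  have hexp : (n + 2) ^ a + (n + 2) ^ 1 < (n + 2) ^ (a + 3) :=
    pow_add_pow_lt n (by omega) (by omega)
  rw [pow_one] at hexp
  have hB' : ∀ e, e ≤ c + (a + 3) * (b + d + 1) + (a + 3) → (n + 2) ^ e ≤ 2 ^ B := fun e he =>
    (pow_le_pow_exp n he).trans hB
  have hBa := hB' (a + 3) (by omega)
  set N := m + n with hN
  have hNpow : ∀ e, e ≤ b + d + 1 → (N + 2) ^ e ≤ 2 ^ B := fun e he => by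
    refine le_trans ?_ (hB' ((a + 3) * e) ?_)
    · rw [pow_mul]
      exact Nat.pow_le_pow_left (by omega) e
    · have := Nat.mul_le_mul_left (a + 3) he
      omega
  set O : ℕ → List DyadicSymbol := fun k =>
    pre ++ (List.range' k (m - k)).reverse.map fun t => if dig n t = 0 then s₀ else s₁ with hO
  set S : ℕ → ℕ → ℕ := fun k i => if i = 0 then n else if i = 1 then k else 0 with hS
  have h₁ := exec_readInput (n := n) (B := B) (by omega)
  have h₂ := RegExec.print (n := n) (B := B) (pos := n + 1)
    (R := fun i => if i = 0 then n else 0) pre []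
  have h₃ := hp n B (n + 1) n (fun i => if i = 0 then n else 0) pre
    (fun r hr => if_neg (by omega)) (by simp) (fun i => by split_ifs <;> omega)
    (hB' c (by omega))
  have h₃' : Function.update (fun i => if i = 0 then n else 0) 1 m = S m := by
    funext i
    simp only [hS, Function.update_apply]
    split_ifs <;> omega
  have hOm : O m = pre := by simp [hO]
  have hO0 : O 0 = pre ++ (List.range m).reverse.map fun t => if dig n t = 0 then s₀ else s₁ := by
    simp [hO, List.range_eq_range']
  simp only [if_true] at h₃
  rw [← hm, h₃'] at h₃
  have h₄ := RegExec.countdown (n := n) (B := B) (pos := n + 1) (p := .seq q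
    (.ite (.nonzero 3) (.seq (.clear 3) (.act (.emit s₁))) (.act (.emit s₀)))) 1 S O m
    (by omega) (fun k _ => by simp [hS]) (fun k hk => by
      have hSk : Function.update (S (k + 1)) 1 k = S k := by
        funext i
        simp only [hS, Function.update_apply]
        split_ifs <;> omega
      have hOk : O k = O (k + 1) ++ [if dig n k = 0 then s₀ else s₁] := by
        simp only [hO]
        rw [show m - k = (m - (k + 1)) + 1 by omega, List.range'_succ]
        simp
      have hdb : dig n k < 2 ^ B := by
        have h : dig n k ≤ (N + 2) ^ b :=
          hb (fun i => if i = 0 then n else k) N (fun i => by split_ifs <;> omega)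
        exact (h.trans_lt (Nat.pow_lt_pow_right (by omega) (Nat.lt_succ_self b))).trans_le
          (hNpow (b + 1) (by omega))
      rw [hSk]
      have g : RegExec n B (n + 1) q (S k) (O (k + 1)) (Function.update (S k) 3 (dig n k))
          (O (k + 1)) := hq n B (n + 1) N (S k) (O (k + 1))
        (fun r hr => by simp only [hS]; split_ifs <;> omega) (by simp [hS])
        (fun i => by simp only [hS]; split_ifs <;> omega) (hNpow d (by omega))
      refine g.seq ?_
      rw [hOk]
      have hS3 : S k 3 = 0 := by simp [hS]
      by_cases h0 : dig n k = 0
      · rw [if_pos h0, h0, ← hS3, Function.update_eq_self]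
        exact Exec.iteFalse (by rw [eval_nonzero, hS3]; rfl) (RegExec.emit s₀)
      · rw [if_neg h0]
        refine Exec.iteTrue (by rw [eval_nonzero]; simpa using h0)
          (RegExec.seq (RegExec.clear 3 (by simpa using hdb) ?_) (RegExec.emit s₁))
        rw [Function.update_idem, ← hS3, Function.update_eq_self])
  rw [hOm, hO0] at h₄
  exact ⟨S 0, h₁.seq (Exec.seq h₂ (Exec.seq h₃ h₄))⟩

end StructuredTM

/-! ### Automatic reals -/

open StructuredTM RadixConversion

theorem natLog_isBigO : (fun n : ℕ => ((Nat.log 2 (n + 2) : ℕ) : ℝ)) =O[atTop]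
    fun n : ℕ => Real.log n := by
  refine IsBigO.of_bound (2 / Real.log 2) ?_
  filter_upwards [eventually_ge_atTop 2] with n hn
  have hn' : (2 : ℝ) ≤ n := by exact_mod_cast hn
  have hlog2 : 0 < Real.log 2 := Real.log_pos (by norm_num)
  have h₁ : ((Nat.log 2 (n + 2) : ℕ) : ℝ) ≤ Real.log (n + 2) / Real.log 2 := by
    have := Real.natLog_le_logb (n + 2) 2
    simpa [Real.logb] using this
  have h₂ : Real.log ((n : ℝ) + 2) ≤ 2 * Real.log n := by
    rw [← Nat.cast_ofNat (R := ℝ) (n := 2), ← Real.log_pow]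
    refine Real.log_le_log (by positivity) ?_
    push_cast
    nlinarith
  have h₃ : 0 ≤ Real.log n := Real.log_nonneg (by linarith)
  rw [Real.norm_of_nonneg (Nat.cast_nonneg _), Real.norm_of_nonneg h₃, div_mul_eq_mul_div]
  exact h₁.trans (div_le_div_of_nonneg_right h₂ hlog2.le)

theorem one_isBigO_log : (fun _ : ℕ => (1 : ℝ)) =O[atTop] fun n : ℕ => Real.log n := by
  refine IsBigO.of_bound (1 / Real.log 2) ?_
  filter_upwards [eventually_ge_atTop 2] with n hn
  have hn' : (2 : ℝ) ≤ n := by exact_mod_cast hn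
  have hlog2 : 0 < Real.log 2 := Real.log_pos (by norm_num)
  have h := Real.log_le_log (by norm_num) hn'
  rw [norm_one, Real.norm_of_nonneg (hlog2.le.trans h), one_div_mul_eq_div, le_div_iff₀ hlog2,
    one_mul]
  exact h

/-- The value of the fractional part printed with the most significant digit first. -/
theorem sum_get_reverse (L : ℕ) (f : ℕ → Fin 2) :
    ∑ j : Fin ((List.range L).reverse.map f).length,
      (((((List.range L).reverse.map f).get j : Fin 2) : ℕ) : ℝ) / 2 ^ ((j : ℕ) + 1) =
    ((∑ t ∈ Finset.range L, (f t : ℕ) * 2 ^ t : ℕ) : ℝ) / 2 ^ L := by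
  have hlen : ((List.range L).reverse.map f).length = L := by simp
  rw [← Fin.sum_congr' _ hlen.symm]
  rw [← Finset.sum_range_reflect, Finset.sum_range]
  push_cast
  rw [Finset.sum_div]
  refine Finset.sum_congr rfl fun j _ => ?_
  have hj := j.2
  simp only [List.get_eq_getElem, List.getElem_map, List.getElem_reverse, List.getElem_range,
    List.length_range, Fin.val_cast]
  rw [div_eq_div_iff (by positivity) (by positivity), mul_assoc, ← pow_add]
  congr 2
  omega

/-- A string of binary digits, most significant digit first, with value `v`. -/
theorem exists_binary (v : ℕ) : ∃ s : List (Fin 2), s ≠ [] ∧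
    Nat.ofDigits 2 (s.reverse.map Fin.val) = v := by
  refine ⟨0 :: (Nat.digits 2 v).reverse.map fun d => ⟨d % 2, Nat.mod_lt _ (by norm_num)⟩,
    by simp, ?_⟩
  have h : (Nat.digits 2 v).map (Fin.val ∘ fun d => (⟨d % 2, Nat.mod_lt _ (by norm_num)⟩ : Fin 2)) =
      Nat.digits 2 v := by
    refine (List.map_congr_left fun d hd => ?_).trans (List.map_id _)
    exact Nat.mod_eq_of_lt (Nat.digits_lt_base (by norm_num) hd)
  simp only [List.reverse_cons, List.map_append, List.map_reverse, List.reverse_reverse,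
    List.map_map, h, List.map_cons, List.map_nil, Nat.ofDigits_append, Nat.ofDigits_digits]
  simp

theorem mainTheorem5 (k b : ℕ) (hk : 2 ≤ k) (hb : 2 ≤ b) (x : ℝ)
    (hx : IsAutomaticReal k b x) : LogspaceComputable x := by
  obtain ⟨a₀, A, hA, hdig, hsum⟩ := hx
  set a : ℕ → ℕ := fun i => (a₀ (i + 1)).toNat with ha_def
  have ha : ∀ i, a i < b := fun i => by
    have := hdig (i + 1) (by omega)
    change (a₀ (i + 1)).toNat < b
    omega
  have hy : HasSum (fun i => (a i : ℝ) / (b : ℝ) ^ (i + 1)) (x - a₀ 0) := by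
    convert hsum using 3 with i
    have := Int.toNat_of_nonneg (hdig (i + 1) (by omega)).1
    exact_mod_cast this
  have hcomp : PolyReg fun ρ => a (ρ 0) :=
    PolyReg.comp₁ (op := fun n => (a₀ n).toNat) (PolyReg.automatic hk a₀ A hA) (PolyReg.var 0).succ
  have hout := polyReg_outDigit hcomp fun i => (ha i).le
  have hprec := (polyReg_parameters b).2.2.2.1
  -- for a negative integer part, `d = -((|a₀| - 1) + (1 - fraction))`, so digits are complemented
  set neg : Bool := decide (a₀ 0 < 0) with hneg
  obtain ⟨s, hs, hsv⟩ := exists_binary (if neg then (-a₀ 0 - 1).toNat else (a₀ 0).toNat)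
  have hsv' : Nat.ofDigits (2 : ℝ) (s.reverse.map Fin.val) =
      ((if neg then (-a₀ 0 - 1).toNat else (a₀ 0).toNat : ℕ) : ℝ) := by
    rw [← hsv, Nat.coe_ofDigits]
    norm_num
  set z₀ : Fin 2 := if neg then 1 else 0 with hz₀
  set z₁ : Fin 2 := if neg then 0 else 1 with hz₁
  obtain ⟨p, c, hp⟩ := exists_printer
    ((if neg then [DyadicSymbol.minus] else []) ++ s.map DyadicSymbol.digit ++ [DyadicSymbol.point])
    (DyadicSymbol.digit z₀) (DyadicSymbol.digit z₁) hprec hout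
  obtain ⟨M, hM⟩ := exists_machine p
  refine ⟨M, fun n => p.bound * (c * (Nat.log 2 (n + 2) + 1) + 2), fun n => ?_, ?_⟩
  · obtain ⟨R, hR⟩ := hp n (c * (Nat.log 2 (n + 2) + 1)) (by
      rw [mul_comm c, pow_mul]
      exact Nat.pow_le_pow_left (Nat.lt_pow_succ_log_self (by norm_num) _).le c)
    obtain ⟨hout, hspace⟩ := hM n _ _ hR
    set L := precision b n with hL
    set f : ℕ → Fin 2 := fun t => if outDigit a b n t = 0 then z₀ else z₁ with hf
    refine ⟨_, _, hout, ⟨neg, s, (List.range L).reverse.map f, hs, ?_, rfl⟩, ?_, hspace⟩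
    · simp only [regMem, List.map_map]
      congr 1
      refine List.map_congr_left fun t _ => ?_
      simp only [hf, Function.comp]
      split_ifs <;> rfl
    · rw [sum_get_reverse, hsv']
      set D : ℕ := ∑ t ∈ Finset.range L, outDigit a b n t * 2 ^ t with hD
      have happ := outDigit_approximates hb ha hy n
      rw [← hL, ← hD] at happ
      have hbit : ∀ t, outDigit a b n t < 2 := fun t => digit_lt_two _ _ _
      have hLn : ((2 : ℝ) ^ L)⁻¹ ≤ (2 ^ (n + 2))⁻¹ :=
        inv_anti₀ (by positivity) (pow_le_pow_right₀ (by norm_num) (le_precision hb n))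
      have hL0 : (0 : ℝ) ≤ (2 ^ L)⁻¹ := by positivity
      have hn4 : ((2 : ℝ) ^ n)⁻¹ = 4 * (2 ^ (n + 2))⁻¹ := by
        rw [pow_add, mul_inv]
        ring
      rw [hn4]
      rw [abs_le] at happ ⊢
      by_cases h0 : a₀ 0 < 0
      · have hn : neg = true := by simp [hneg, h0]
        have hfs : (∑ t ∈ Finset.range L, (f t : ℕ) * 2 ^ t) + D + 1 = 2 ^ L := by
          rw [hD, ← Finset.sum_add_distrib]
          have : ∀ t ∈ Finset.range L, (f t : ℕ) * 2 ^ t + outDigit a b n t * 2 ^ t = 2 ^ t := by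
            intro t _
            have := hbit t
            simp only [hf, hz₀, hz₁, hn, if_true]
            split_ifs with h
            · simp [h]
            · have : outDigit a b n t = 1 := by omega
              simp [this]
          rw [Finset.sum_congr rfl this, Nat.geomSum_eq le_rfl]
          have := Nat.one_le_two_pow (n := L)
          omega
        have hfs' : ((∑ t ∈ Finset.range L, (f t : ℕ) * 2 ^ t : ℕ) : ℝ) = 2 ^ L - D - 1 := by
          have : (((∑ t ∈ Finset.range L, (f t : ℕ) * 2 ^ t) + D + 1 : ℕ) : ℝ) = 2 ^ L := by
            rw [hfs]; push_cast; rfl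
          push_cast at this ⊢
          linarith
        have hint : (((-a₀ 0 - 1).toNat : ℕ) : ℝ) = -a₀ 0 - 1 := by
          have := Int.toNat_of_nonneg (show 0 ≤ -a₀ 0 - 1 by omega)
          exact_mod_cast this
        have hdiv : ((2 : ℝ) ^ L - D - 1) / 2 ^ L = 1 - D / 2 ^ L - (2 ^ L)⁻¹ := by
          field_simp
        rw [hfs', hdiv]
        simp only [hn, if_true, hint]
        constructor <;> linarith
      · have hn : neg = false := by simp [hneg, h0]
        have hfs : ∑ t ∈ Finset.range L, (f t : ℕ) * 2 ^ t = D := by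
          refine Finset.sum_congr rfl fun t _ => ?_
          have := hbit t
          simp only [hf, hz₀, hz₁, hn, Bool.false_eq_true, if_false]
          split_ifs with h
          · simp [h]
          · have : outDigit a b n t = 1 := by omega
            simp [this]
        have hint : (((a₀ 0).toNat : ℕ) : ℝ) = a₀ 0 := by
          have := Int.toNat_of_nonneg (show 0 ≤ a₀ 0 by omega)
          exact_mod_cast this
        rw [hfs]
        simp only [hn, Bool.false_eq_true, if_false, hint]
        constructor <;> linarith
  · have h : (fun n : ℕ => ((p.bound * (c * (Nat.log 2 (n + 2) + 1) + 2) : ℕ) : ℝ)) =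
        fun n : ℕ => (p.bound * c : ℝ) * (Nat.log 2 (n + 2) : ℕ) + (p.bound * (c + 2) : ℝ) * 1 := by
      funext n
      push_cast
      ring
    rw [h]
    exact (natLog_isBigO.const_mul_left _).add (one_isBigO_log.const_mul_left _)
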